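/- **Setting.** Let $d\in\{2,3\}$ and let $\Omega\subset\mathbb R^d$ be a bounded open set. Write $\|\cdot\|$ and $(\cdot,\cdot)$ for the $L^2(\Omega)$ norm and inner product, $X=H^1_0(\Omega)^d$ (the closure of the smooth compactly supported vector fields in the $H^1$ norm), $Q=L^2_0(\Omega)$, and $$b(\chi,v,w)=\tfrac12(\chi\cdot\nabla v,w)-\tfrac12(\chi\cdot\nabla w,v),\qquad \chi,v,w\in X.$$ For $f\in X'$ let $\|f\|_{-1}=\sup_{0\ne v\in X}\langle f,v\rangle/\|\nabla v\|$. There are constants $C_P>0$ and $M>0$, depending only on $\Omega$ (and $d$), such that for all $\chi,v,w\in X$ $$\|v\|\le C_P\|\nabla v\|,$$ $$b(\chi,v,w)\le M\|\chi\|^{1/2}\|\nabla\chi\|^{1/2}\|\nabla v\|\|\nabla w\|,\quad b(\chi,v,w)\le M\|\nabla\chi\|\|v\|^{1/2}\|\nabla v\|^{1/2}\|\nabla w\|,\quad b(\chi,v,w)\le M\|\nabla\chi\|\|\nabla v\|\|\nabla w\|.$$ Let $C_P>0$ and $M>0$ be any constants with these properties. Let $X_h\subset X$ and $\{0\}\ne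 Q_h\subset Q$ be linear (for example finite element) subspaces and let $\beta>0$ satisfy $$\inf_{0\ne q\in Q_h}\ \sup_{0\ne v\in X_h}\frac{(\nabla\cdot v,q)}{\|q\|\,\|\nabla v\|}\ge\beta .$$ Let $H,C_1>0$ and let $I_H:X\to L^2(\Omega)^d$ be a linear map such that $\|I_Hv-v\|\le C_1H\|\nabla v\|$ and $\|I_Hv\|\le C_1\|v\|$ for all $v\in X$. Let $\nu>0$, $\mu,\gamma\in\mathbb R$, $f\in X'$, and put $$\alpha=M\nu^{-2}\|f\|_{-1},\quad R=204\sqrt2\,\nu^{-1}C_1\beta^{-2}+24\sqrt2\,\nu^{-1/2}C_1\beta^{-2}+204\sqrt2\,C_1\beta^{-2},\quad \lambda=\min\Big\{\mu,\frac{\nu}{2C_1^2H^2}\Big\}.$$ Let $(u,p)\in X_h\times Q_h$ be a (finite element, grad-div stabilized) solution of the steady Navier–Stokes equations, that is, for all $(v,q)\in X_h\times Q_h$, $$\nu(\nabla u,\nabla v)+b(u,u,v)-(p,\nabla\cdot v)+\gamma(\nabla\cdot u,\nabla\cdot v)=\langle f,v\rangle,\qquad(\nabla\cdot u,q)=0 .$$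 **One step of CDA-IPY.** Given $I_Hu$ and $(u_{k-1},p_{k-1})\in X_h\times Q_h$: (1) find $z_k\in X_h$ with, for all $v\in X_h$, $$\nu(\nabla z_k,\nabla v)+\gamma(\nabla\cdot z_k,\nabla\cdot v)+b(u_{k-1},z_k,v)+\mu(I_Hz_k,I_Hv)=\langle f,v\rangle+\mu(I_Hu,I_Hv)+(p_{k-1},\nabla\cdot v);$$ (2) find $(w_k,\delta_k^p)\in X_h\times Q_h$ with, for all $(v,q)\in X_h\times Q_h$, $$\nu(\nabla w_k,\nabla v)+\gamma(\nabla\cdot w_k,\nabla\cdot v)-(\delta_k^p,\nabla\cdot v)+\mu(I_Hw_k,I_Hv)=0,\qquad(\nabla\cdot w_k,q)=-(\nabla\cdot z_k,q);$$ (3) set $p_k=p_{k-1}+\delta_k^p$ and find $u_k\in X_h$ with, for all $v\in X_h$, $$\nu(\nabla u_k,\nabla v)+\gamma(\nabla\cdot u_k,\nabla\cdot v)+b(u_{k-1},u_k,v)+\mu(I_Hu_k,I_Hv)=\langle f,v\rangle+\mu(I_Hu,I_Hv)+(p_k,\nabla\cdot v).$$ **Theorem (convergence of CDA-IPY).** Assume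 $\nu\|\nabla(u_{k-1}-u)\|^2\le\|\nabla u\|^2$, $$H\le\min\Big\{\frac1{\alpha^2R},\ \frac{101}{204\sqrt2\,C_1\alpha^2}\Big\}\quad(\text{no restriction if }\alpha=0),$$ $$\mu\ge\max\Big\{\nu\alpha^2,\ \frac{\nu}{2C_1^2H^2}\Big\},\qquad \gamma\ge\max\Big\{\frac{2\mu^2C_1^6C_P^2H^2}{\nu},\ \nu\Big\}.$$ Then every result $(u_k,p_k)$ of one step of CDA-IPY satisfies $$\frac\nu4\|\nabla(u-u_k)\|^2+\lambda\|u-u_k\|^2+\frac{\gamma^{-1}}2\|p-p_k\|^2\le\alpha^2HR\Big(\frac\nu4\|\nabla(u-u_{k-1})\|^2+\lambda\|u-u_{k-1}\|^2+\frac{\gamma^{-1}}2\|p-p_{k-1}\|^2\Big).$$ -/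

import Mathlib

open MeasureTheory
open scoped ContDiff

noncomputable section

namespace CDAIPY

/-- The space `ℝ^d` with its Euclidean norm. -/
abbrev Vec (d : ℕ) := EuclideanSpace ℝ (Fin d)

/-- Real `d × d` matrices with the Frobenius inner product. -/
abbrev Mat (d : ℕ) := EuclideanSpace ℝ (Fin d × Fin d)

/-- `L²(Ω; F)` with Lebesgue measure on `Ω`. -/
abbrev L2 {d : ℕ} (Ω : Set (Vec d)) (F : Type) [NormedAddCommGroup F] :=
  Lp F 2 ((volume : Measure (Vec d)).restrict Ω)

/-- The Jacobian matrix of `φ` at `x`: the entry `(i, j)` is `∂φ_i / ∂x_j`. -/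
def jac {d : ℕ} (φ : Vec d → Vec d) (x : Vec d) : Mat d :=
  WithLp.toLp 2 fun ij => fderiv ℝ φ x (EuclideanSpace.single ij.2 1) ij.1

/-- The pairs `(φ, ∇φ)`, as elements of `L² × L²`, for `φ` a smooth vector field with compact
support in `Ω`. -/
def testGraph {d : ℕ} (Ω : Set (Vec d)) : Submodule ℝ (L2 Ω (Vec d) × L2 Ω (Mat d)) where
  carrier := {P | ∃ φ : Vec d → Vec d, ContDiff ℝ ∞ φ ∧ HasCompactSupport φ ∧ tsupport φ ⊆ Ω ∧
    P.1 =ᵐ[volume.restrict Ω] φ ∧ P.2 =ᵐ[volume.restrict Ω] jac φ}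
  zero_mem' := by
    refine ⟨0, contDiff_const, HasCompactSupport.zero, by simp [tsupport], ?_, ?_⟩
    · exact Lp.coeFn_zero _ _ _
    · filter_upwards [Lp.coeFn_zero (Mat d) 2 (volume.restrict Ω)] with x hx
      refine hx.trans ?_
      ext ij
      simp [jac]
  add_mem' := by
    rintro P P' ⟨φ, h1, h2, h3, h4, h5⟩ ⟨ψ, k1, k2, k3, k4, k5⟩
    refine ⟨φ + ψ, h1.add k1, h2.add k2,
      (tsupport_add φ ψ).trans (Set.union_subset h3 k3), ?_, ?_⟩
    · filter_upwards [Lp.coeFn_add P.1 P'.1, h4, k4] with x hx hx4 kx4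
      simp only [Prod.fst_add, Pi.add_apply] at hx ⊢
      rw [hx, hx4, kx4]
    · filter_upwards [Lp.coeFn_add P.2 P'.2, h5, k5] with x hx hx5 kx5
      simp only [Prod.snd_add, Pi.add_apply] at hx ⊢
      rw [hx, hx5, kx5]
      ext ij
      simp [jac, fderiv_add (h1.differentiable (by simp) x) (k1.differentiable (by simp) x)]
  smul_mem' := by
    rintro c P ⟨φ, h1, h2, h3, h4, h5⟩
    refine ⟨c • φ, h1.const_smul c, HasCompactSupport.smul_left (f := fun _ => c) h2,
      (closure_mono (Function.support_const_smul_subset c φ)).trans h3, ?_, ?_⟩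
    · filter_upwards [Lp.coeFn_smul c P.1, h4] with x hx hx4
      simp only [Prod.smul_fst, Pi.smul_apply] at hx ⊢
      rw [hx, hx4]
    · filter_upwards [Lp.coeFn_smul c P.2, h5] with x hx hx5
      simp only [Prod.smul_snd, Pi.smul_apply] at hx ⊢
      rw [hx, hx5]
      ext ij
      simp [jac, fderiv_const_smul (h1.differentiable (by simp) x)]

/-- The velocity space `X = H₀¹(Ω)^d`: the closure of the smooth compactly supported vector fields
in the `H¹` norm. An element is carried as the pair `(v, ∇v)` of the function and its weak
gradient, which `v` determines. -/
def H10 {d : ℕ} (Ω : Set (Vec d)) : Submodule ℝ (L2 Ω (Vec d) × L2 Ω (Mat d)) :=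
  (testGraph Ω).topologicalClosure

section ops

variable {d : ℕ} {Ω : Set (Vec d)}

/-- The function underlying an element of `H₀¹(Ω)^d`. -/
def val (v : H10 Ω) : L2 Ω (Vec d) := v.1.1

/-- The weak gradient, with entries `(i, j) ↦ ∂v_i / ∂x_j`. -/
def grad (v : H10 Ω) : L2 Ω (Mat d) := v.1.2

/-- The trace of a matrix. -/
def traceCLM (d : ℕ) : Mat d →L[ℝ] ℝ :=
  ∑ i : Fin d, (EuclideanSpace.proj (i, i) : Mat d →L[ℝ] ℝ)

/-- The divergence `∇ · v ∈ L²(Ω)`. -/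
def dive (v : H10 Ω) : L2 Ω ℝ := (traceCLM d).compLp (grad v)

/-- `(χ · ∇v, w) = ∫_Ω ∑_i ∑_j χ_j (∂v_i / ∂x_j) w_i`. -/
def conv (χ v w : H10 Ω) : ℝ :=
  ∫ x in Ω, ∑ i : Fin d, ∑ j : Fin d, val χ x j * grad v x (i, j) * val w x i

/-- The skew-symmetric trilinear form `b(χ, v, w) = ½ (χ · ∇v, w) - ½ (χ · ∇w, v)`. -/
def b (χ v w : H10 Ω) : ℝ := (1 / 2) * conv χ v w - (1 / 2) * conv χ w v

/-- The norm `‖f‖₋₁ = sup_v ⟨f, v⟩ / ‖∇v‖` of the dual space of `X` (`v = 0` contributes `0`). -/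
def dualNorm (f : H10 Ω →L[ℝ] ℝ) : ℝ := ⨆ v : H10 Ω, f v / ‖grad v‖

/-- The discrete inf-sup (LBB) condition with constant `β`. -/
def InfSup (Xh : Submodule ℝ (H10 Ω)) (Qh : Submodule ℝ (L2 Ω ℝ)) (β : ℝ) : Prop :=
  0 < β ∧ ∀ q ∈ Qh, q ≠ 0 →
    β ≤ ⨆ v : {v : H10 Ω // v ∈ Xh ∧ v ≠ 0}, inner ℝ (dive v.1) q / (‖q‖ * ‖grad v.1‖)

/-- `(u, p) ∈ X_h × Q_h` is a finite element solution of the steady Navier-Stokes equations with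
grad-div stabilization. -/
def IsNSESolution (Xh : Submodule ℝ (H10 Ω)) (Qh : Submodule ℝ (L2 Ω ℝ)) (ν γ : ℝ)
    (f : H10 Ω →L[ℝ] ℝ) (u : H10 Ω) (p : L2 Ω ℝ) : Prop :=
  u ∈ Xh ∧ p ∈ Qh ∧
  (∀ v ∈ Xh, ν * inner ℝ (grad u) (grad v) + b u u v - inner ℝ p (dive v)
    + γ * inner ℝ (dive u) (dive v) = f v) ∧
  (∀ q ∈ Qh, inner ℝ (dive u) q = 0)

/-- One step of CDA-IPY: `(u', p')` results from `(u₀, p₀)`, where `g` is the known data `I_H u`.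
The velocity of the second substep is `w`, and `δ` is the pressure increment. -/
def IsCDAIPYStep (Xh : Submodule ℝ (H10 Ω)) (Qh : Submodule ℝ (L2 Ω ℝ)) (ν γ μ : ℝ)
    (f : H10 Ω →L[ℝ] ℝ) (IH : H10 Ω →ₗ[ℝ] L2 Ω (Vec d)) (g : L2 Ω (Vec d))
    (u₀ : H10 Ω) (p₀ : L2 Ω ℝ) (u' : H10 Ω) (p' : L2 Ω ℝ) : Prop :=
  ∃ z ∈ Xh, ∃ w ∈ Xh, ∃ δ ∈ Qh,
    (∀ v ∈ Xh, ν * inner ℝ (grad z) (grad v) + γ * inner ℝ (dive z) (dive v) + b u₀ z v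
      + μ * inner ℝ (IH z) (IH v) = f v + μ * inner ℝ g (IH v) + inner ℝ p₀ (dive v)) ∧
    (∀ v ∈ Xh, ν * inner ℝ (grad w) (grad v) + γ * inner ℝ (dive w) (dive v)
      - inner ℝ δ (dive v) + μ * inner ℝ (IH w) (IH v) = 0) ∧
    (∀ q ∈ Qh, inner ℝ (dive w) q = -inner ℝ (dive z) q) ∧
    p' = p₀ + δ ∧
    u' ∈ Xh ∧
    (∀ v ∈ Xh, ν * inner ℝ (grad u') (grad v) + γ * inner ℝ (dive u') (dive v) + b u₀ u' v
      + μ * inner ℝ (IH u') (IH v) = f v + μ * inner ℝ g (IH v) + inner ℝ p' (dive v))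

end ops

/-- `C_P` is a Poincaré-Friedrichs constant of `Ω`. -/
def IsPoincareConst {d : ℕ} (Ω : Set (Vec d)) (CP : ℝ) : Prop :=
  0 < CP ∧ ∀ v : H10 Ω, ‖val v‖ ≤ CP * ‖grad v‖

/-- `M` is a constant for the bounds of the trilinear form `b` on `Ω`. -/
def IsTrilinearConst {d : ℕ} (Ω : Set (Vec d)) (M : ℝ) : Prop :=
  0 < M ∧ ∀ χ v w : H10 Ω,
    b χ v w ≤ M * √‖val χ‖ * √‖grad χ‖ * ‖grad v‖ * ‖grad w‖ ∧
    b χ v w ≤ M * ‖grad χ‖ * √‖val v‖ * √‖grad v‖ * ‖grad w‖ ∧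
    b χ v w ≤ M * ‖grad χ‖ * ‖grad v‖ * ‖grad w‖

/-- The pressure space `Q = L²₀(Ω)`. -/
def L20 {d : ℕ} (Ω : Set (Vec d)) : Set (L2 Ω ℝ) := {q | ∫ x in Ω, q x = 0}

/-- `α = M ν⁻² ‖f‖₋₁`. -/
def alpha {d : ℕ} {Ω : Set (Vec d)} (M ν : ℝ) (f : H10 Ω →L[ℝ] ℝ) : ℝ :=
  M * (ν ^ 2)⁻¹ * dualNorm f

/-- `R = 204√2 ν⁻¹ C₁ β⁻² + 24√2 ν^{-1/2} C₁ β⁻² + 204√2 C₁ β⁻²`. -/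
def RConst (ν C₁ β : ℝ) : ℝ :=
  204 * √2 * ν⁻¹ * C₁ * (β ^ 2)⁻¹ + 24 * √2 * (√ν)⁻¹ * C₁ * (β ^ 2)⁻¹
    + 204 * √2 * C₁ * (β ^ 2)⁻¹

/-- `λ = min {μ, ν / (2 C₁² H²)}`. -/
def lam (ν μ C₁ H : ℝ) : ℝ := min μ (ν / (2 * C₁ ^ 2 * H ^ 2))

/-- The combined error `(ν/4) ‖∇e‖² + λ ‖e‖² + (γ⁻¹/2) ‖r‖²`. -/
def errE {d : ℕ} {Ω : Set (Vec d)} (ν γ l : ℝ) (e : H10 Ω) (r : L2 Ω ℝ) : ℝ :=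
  ν / 4 * ‖grad e‖ ^ 2 + l * ‖val e‖ ^ 2 + γ⁻¹ / 2 * ‖r‖ ^ 2

end CDAIPY

end

open CDAIPY

/-! Write e, r and e₀, r₀ for the velocity and pressure errors after and before the step, E for the
combined error before it, and a for the form `stepForm`. Three facts give the contraction.

Small convection: put c = √2 C₁H. The lower bound on μ makes λ = ν/c², and Young's inequality with
weight c turns ‖v‖^{1/2}‖∇v‖^{1/2} into √c times the square root of the velocity error `velE`, up to
powers of ν (`mul_sqrt_mul_sqrt_le`). So each convection term carries a factor √k with k = (α(1 +
ν^{-1/2}))² c, which is of order H.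

Small splitting error: y = u' - z - w is driven only by b(u₀, w, ·), and w only by the pressure
increment r₀ - r, so a(y, y) ≤ k(‖r‖² + ‖r₀‖²)/γ. Since e + y = u - z - w is discretely divergence
free, testing with it removes the pressure and bounds a(e, e) by a multiple of k(E + ‖r‖²/γ).

Pressure recovery: the inf-sup condition bounds β²‖r‖²/γ by a(e, e) and the convection terms. The
pressure error thus returns on the right with a factor of order k, absorbed because α²HR ≤ 1 implies
108k ≤ β². The arithmetic is `contraction_of_scalar_bounds`, the assembly `sq_mul_errE_le`.

The constants C_P and M exist by the Sobolev embedding into L⁶, Hölder's inequality and integration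
by parts, proved for test fields and extended by density. -/

namespace CDAIPY

/-! ### Pointwise matrix bounds and the Sobolev inequality for test fields. -/

variable {d : ℕ}

theorem sum_sq_matVec_le (G : Mat d) (a : Vec d) :
    ∑ i, (∑ j, a j * G (i, j)) ^ 2 ≤ (‖a‖ * ‖G‖) ^ 2 := by
  rw [mul_pow, EuclideanSpace.norm_sq_eq, EuclideanSpace.norm_sq_eq, Fintype.sum_prod_type,
    Finset.mul_sum]
  refine Finset.sum_le_sum fun i _ => ?_
  simpa using Finset.sum_mul_sq_le_sq_mul_sq Finset.univ (fun j => a j) (fun j => G (i, j))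

theorem abs_sum_sum_le (G : Mat d) (a w : Vec d) :
    |∑ i, ∑ j, a j * G (i, j) * w i| ≤ ‖a‖ * ‖G‖ * ‖w‖ := by
  refine abs_le_of_sq_le_sq ?_ (by positivity)
  have h := Finset.sum_mul_sq_le_sq_mul_sq Finset.univ (fun i => ∑ j, a j * G (i, j)) (fun i => w i)
  simp only [← Finset.sum_mul]
  refine h.trans ?_
  rw [mul_pow _ ‖w‖, EuclideanSpace.norm_sq_eq w]
  simp only [Real.norm_eq_abs, sq_abs]
  exact mul_le_mul_of_nonneg_right (sum_sq_matVec_le G a)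
    (Finset.sum_nonneg fun i _ => sq_nonneg _)

/-- Links the Sobolev inequality, which uses the operator norm of the derivative, to the Frobenius
norm used for ∇v. -/
theorem norm_fderiv_le_norm_jac (φ : Vec d → Vec d) (x : Vec d) :
    ‖fderiv ℝ φ x‖ ≤ ‖jac φ x‖ := by
  refine ContinuousLinearMap.opNorm_le_bound _ (norm_nonneg _) fun v => ?_
  refine abs_le_of_sq_le_sq' ?_ (by positivity) |>.2
  rw [mul_comm, EuclideanSpace.norm_sq_eq]
  refine le_trans (le_of_eq ?_) (sum_sq_matVec_le (jac φ x) v)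
  refine Finset.sum_congr rfl fun i _ => ?_
  have hv : v = ∑ j, v j • EuclideanSpace.single j (1 : ℝ) := by
    ext k
    simp [Pi.single_apply]
  conv_lhs => rw [hv]
  simp [map_sum, jac]

theorem fderiv_apply_coord {φ : Vec d → Vec d} {x : Vec d} (h : DifferentiableAt ℝ φ x)
    (i : Fin d) (v : Vec d) :
    fderiv ℝ (fun y => φ y i) x v = fderiv ℝ φ x v i := by
  have := ((EuclideanSpace.proj i : Vec d →L[ℝ] ℝ).hasFDerivAt.comp x h.hasFDerivAt).fderiv
  exact DFunLike.congr_fun this v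

theorem jac_apply {φ : Vec d → Vec d} (h : Differentiable ℝ φ) (x : Vec d) (i j : Fin d) :
    jac φ x (i, j) = fderiv ℝ (fun y => φ y i) x (EuclideanSpace.single j 1) := by
  rw [fderiv_apply_coord (h x)]; rfl

/-- The `L⁶` norm of a test function is controlled by the `L²` norm of its gradient. -/
theorem exists_eLpNorm_six_le_of_test (hd : d = 2 ∨ d = 3) {Ω : Set (Vec d)}
    (hΩb : Bornology.IsBounded Ω) :
    ∃ C : NNReal, ∀ φ : Vec d → Vec d, ContDiff ℝ ∞ φ → tsupport φ ⊆ Ω →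
      eLpNorm φ 6 (volume.restrict Ω) ≤ C * eLpNorm (jac φ) 2 (volume.restrict Ω) := by
  -- The Sobolev conjugate of p is exactly 6: 2/3 - 1/2 = 1/6 in the plane and 1/2 - 1/3 = 1/6 in
  -- space. The requirement p < d rules out p = 2 in the plane.
  obtain ⟨p, hp1, hpd, hp2, hp6⟩ : ∃ p : NNReal, 1 ≤ p ∧ p < (d : NNReal) ∧ p ≤ 2 ∧
      (p : ℝ)⁻¹ - (d : ℝ)⁻¹ ≤ (6 : ℝ)⁻¹ := by
    rcases hd with rfl | rfl
    · exact ⟨3 / 2, by rw [← NNReal.coe_le_coe]; norm_num, by rw [← NNReal.coe_lt_coe]; norm_num,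
        by rw [← NNReal.coe_le_coe]; norm_num, by push_cast; norm_num⟩
    · exact ⟨2, by norm_num, by norm_num, le_rfl, by push_cast; norm_num⟩
  set c := (volume Ω).toNNReal ^ (1 / (p : ℝ) - 1 / 2)
  refine ⟨eLpNormLESNormFDerivOfLeConst (Vec d) (volume : Measure (Vec d)) Ω p 6 * c,
    fun φ hφ hs => ?_⟩
  have hsupp : φ.support ⊆ Ω := (subset_tsupport φ).trans hs
  have h1 := eLpNorm_le_eLpNorm_fderiv_of_le (volume : Measure (Vec d)) (p := p) (q := 6)
    (hφ.of_le (by simp)) hsupp hp1 (by simpa using hpd) (by simpa using hp6) hΩb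
  have hds : (fderiv ℝ φ).support ⊆ Ω := (support_fderiv_subset ℝ).trans hs
  rw [← eLpNorm_restrict_eq_of_support_subset hsupp,
    ← eLpNorm_restrict_eq_of_support_subset (f := fderiv ℝ φ) hds] at h1
  refine h1.trans ?_
  have hcont : Continuous (fderiv ℝ φ) := hφ.continuous_fderiv (by simp)
  -- Ω has finite measure, so Hölder's inequality passes from the exponent p ≤ 2 to 2.
  have h2 : eLpNorm (fderiv ℝ φ) p (volume.restrict Ω) ≤
      eLpNorm (fderiv ℝ φ) 2 (volume.restrict Ω) * c := by
    have := eLpNorm_le_eLpNorm_mul_rpow_measure_univ (μ := volume.restrict Ω)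
      (p := p) (q := 2) (by exact_mod_cast hp2) hcont.aestronglyMeasurable
    convert this using 2
    have hfin : volume Ω ≠ ⊤ := hΩb.measure_lt_top.ne
    have hp0 : (0 : ℝ) < p := lt_of_lt_of_le one_pos hp1
    have hp2' : (p : ℝ) ≤ 2 := hp2
    rw [ENNReal.coe_rpow_of_nonneg, ENNReal.coe_toNNReal hfin]
    · simp
    · rw [sub_nonneg]; gcongr
  have h3 : eLpNorm (fderiv ℝ φ) 2 (volume.restrict Ω) ≤ eLpNorm (jac φ) 2 (volume.restrict Ω) :=
    eLpNorm_mono fun x => norm_fderiv_le_norm_jac φ x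
  push_cast
  rw [mul_assoc]
  gcongr
  refine h2.trans ?_
  rw [mul_comm]
  gcongr

end CDAIPY

/-! ### Linear structure of H₀¹ and reduction to test fields. -/

namespace CDAIPY

open Filter Topology

variable {d : ℕ} {Ω : Set (Vec d)}

theorem val_add (v w : H10 Ω) : val (v + w) = val v + val w := rfl
theorem val_smul (c : ℝ) (v : H10 Ω) : val (c • v) = c • val v := rfl
theorem grad_add (v w : H10 Ω) : grad (v + w) = grad v + grad w := rfl
theorem grad_sub (v w : H10 Ω) : grad (v - w) = grad v - grad w := rfl
theorem grad_neg (v : H10 Ω) : grad (-v) = -grad v := rfl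
theorem grad_smul (c : ℝ) (v : H10 Ω) : grad (c • v) = c • grad v := rfl

theorem dive_add (v w : H10 Ω) : dive (v + w) = dive v + dive w := by
  exact ((traceCLM d).compLpL 2 (volume.restrict Ω)).map_add _ _

theorem dive_smul (c : ℝ) (v : H10 Ω) : dive (c • v) = c • dive v := by
  exact ((traceCLM d).compLpL 2 (volume.restrict Ω)).map_smul c _

theorem dive_neg (v : H10 Ω) : dive (-v) = -dive v := by
  rw [← neg_one_smul ℝ v, dive_smul, neg_one_smul]

theorem dive_sub (v w : H10 Ω) : dive (v - w) = dive v - dive w := by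
  rw [sub_eq_add_neg, dive_add, dive_neg, sub_eq_add_neg]

theorem continuous_val : Continuous (val : H10 Ω → _) := continuous_fst.comp continuous_subtype_val
theorem continuous_grad : Continuous (grad : H10 Ω → _) :=
  continuous_snd.comp continuous_subtype_val
theorem continuous_dive : Continuous (dive : H10 Ω → _) :=
  ((traceCLM d).compLpL 2 (volume.restrict Ω)).continuous.comp continuous_grad

theorem norm_val_le (v : H10 Ω) : ‖val v‖ ≤ ‖v‖ := norm_fst_le v.1
theorem norm_grad_le (v : H10 Ω) : ‖grad v‖ ≤ ‖v‖ := norm_snd_le v.1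

theorem dive_ae (v : H10 Ω) :
    ∀ᵐ x ∂volume.restrict Ω, dive v x = ∑ i, grad v x (i, i) := by
  filter_upwards [(traceCLM d).coeFn_compLp (grad v)] with x hx
  rw [dive, hx]
  simp [traceCLM]

/-- The element `v` of `H₀¹(Ω)^d` is represented by the test function `φ`. -/
structure IsTest (φ : Vec d → Vec d) (v : H10 Ω) : Prop where
  contDiff : ContDiff ℝ ∞ φ
  hasCompactSupport : HasCompactSupport φ
  tsupport_subset : tsupport φ ⊆ Ω
  val_ae : val v =ᵐ[volume.restrict Ω] φ
  grad_ae : grad v =ᵐ[volume.restrict Ω] jac φ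

/-- A closed property of elements of `H₀¹(Ω)^d` holds if it holds for test functions. -/
theorem induction_of_test {P : H10 Ω → Prop} (hP : IsClosed {v | P v})
    (h : ∀ φ v, IsTest φ v → P v) (v : H10 Ω) : P v := by
  have hv : v.1 ∈ closure (testGraph Ω : Set (L2 Ω (Vec d) × L2 Ω (Mat d))) := v.2
  obtain ⟨x, hx, hlim⟩ := mem_closure_iff_seq_limit.1 hv
  let y : ℕ → H10 Ω := fun n => ⟨x n, subset_closure (hx n)⟩
  have hy : Tendsto y atTop (𝓝 v) := tendsto_subtype_rng.2 hlim
  refine hP.mem_of_tendsto hy (Eventually.of_forall fun n => ?_)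
  obtain ⟨φ, h1, h2, h3, h4, h5⟩ := hx n
  exact h φ (y n) ⟨h1, h2, h3, h4, h5⟩

/-! ### Embedding of H₀¹ into L⁶ and the Poincaré inequality. -/

theorem isClosed_eLpNorm_val_le (p : ENNReal) (C : NNReal) :
    IsClosed {v : H10 Ω | eLpNorm (val v) p (volume.restrict Ω) ≤ C * ‖grad v‖ₑ} := by
  refine IsSeqClosed.isClosed fun x v hx hlim => ?_
  have hval := (continuous_val.tendsto v).comp hlim
  -- Along an a.e. convergent subsequence Fatou's lemma makes the left side lower semicontinuous,
  -- while the right side is continuous.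
  obtain ⟨ns, hns, hae⟩ := (tendstoInMeasure_of_tendsto_Lp hval).exists_seq_tendsto_ae
  refine (Lp.eLpNorm_lim_le_liminf_eLpNorm
    (fun n => Lp.aestronglyMeasurable (val (x (ns n)))) _ hae).trans ?_
  have hg : Tendsto (fun n => (C : ENNReal) * ‖grad (x (ns n))‖ₑ) atTop
      (𝓝 (C * ‖grad v‖ₑ)) :=
    ENNReal.Tendsto.const_mul
      (((continuous_enorm.comp continuous_grad).tendsto v).comp (hlim.comp hns.tendsto_atTop))
      (Or.inr ENNReal.coe_ne_top)
  rw [← hg.liminf_eq]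
  exact liminf_le_liminf (Eventually.of_forall fun n => hx (ns n))

theorem exists_eLpNorm_six_le (hd : d = 2 ∨ d = 3) (hΩb : Bornology.IsBounded Ω) :
    ∃ C : NNReal, ∀ v : H10 Ω, eLpNorm (val v) 6 (volume.restrict Ω) ≤ C * ‖grad v‖ₑ := by
  obtain ⟨C, hC⟩ := exists_eLpNorm_six_le_of_test hd hΩb
  refine ⟨C, induction_of_test (isClosed_eLpNorm_val_le 6 C) fun φ v h => ?_⟩
  rw [Lp.enorm_def, eLpNorm_congr_ae h.val_ae, eLpNorm_congr_ae h.grad_ae]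
  exact hC φ h.contDiff h.tsupport_subset

theorem exists_isPoincareConst (hd : d = 2 ∨ d = 3) (hΩb : Bornology.IsBounded Ω) :
    ∃ CP : ℝ, IsPoincareConst Ω CP := by
  obtain ⟨C, hC⟩ := exists_eLpNorm_six_le hd hΩb
  set c : ENNReal := volume.restrict Ω Set.univ ^ (1 / 2 - 1 / 6 : ℝ)
  have hc : c ≠ ⊤ := by
    refine ENNReal.rpow_ne_top_of_nonneg (by norm_num) ?_
    simpa using hΩb.measure_lt_top.ne
  refine ⟨C * c.toReal + 1, by positivity, fun v => ?_⟩
  have h : ‖val v‖ₑ ≤ C * ‖grad v‖ₑ * c := by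
    rw [Lp.enorm_def]
    refine (eLpNorm_le_eLpNorm_mul_rpow_measure_univ (q := 6) (by norm_num)
      (Lp.aestronglyMeasurable _)).trans ?_
    gcongr
    · exact hC v
    · exact le_of_eq (by simp [c])
  have h2 := ENNReal.toReal_mono (by finiteness) h
  simp only [toReal_enorm, ENNReal.toReal_mul, ENNReal.coe_toReal] at h2
  nlinarith [norm_nonneg (grad v)]

/-! ### Hölder bounds and multilinearity of the convection and divergence forms. -/

/-- Hölder's inequality with exponents `3`, `2`, `6`, the `L³` norm being interpolated between
`L²` and `L⁶`. -/
theorem lintegral_enorm_mul_mul_le {α E F G : Type*} [MeasurableSpace α] {m : Measure α}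
    [NormedAddCommGroup E] [NormedAddCommGroup F] [NormedAddCommGroup G]
    {a : α → E} {g : α → F} {w : α → G} (ha : AEStronglyMeasurable a m)
    (hg : AEStronglyMeasurable g m) (hw : AEStronglyMeasurable w m) :
    ∫⁻ x, ‖a x‖ₑ * ‖g x‖ₑ * ‖w x‖ₑ ∂m ≤
      eLpNorm a 2 m ^ (1 / 2 : ℝ) * eLpNorm a 6 m ^ (1 / 2 : ℝ) * eLpNorm g 2 m *
        eLpNorm w 6 m := by
  -- The factor |a| is split as (|a|²)^{1/4} (|a|⁶)^{1/12}; the four weights 1/4, 1/12, 1/2, 1/6 sum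
  -- to 1.
  have key := ENNReal.lintegral_prod_norm_pow_le (μ := m) (Finset.univ : Finset (Fin 4))
    (f := ![fun x => ‖a x‖ₑ ^ (2 : ℝ), fun x => ‖a x‖ₑ ^ (6 : ℝ), fun x => ‖g x‖ₑ ^ (2 : ℝ),
      fun x => ‖w x‖ₑ ^ (6 : ℝ)]) (p := ![1 / 4, 1 / 12, 1 / 2, 1 / 6])
    (by
      intro i _
      fin_cases i
      · exact ha.enorm.pow_const _
      · exact ha.enorm.pow_const _
      · exact hg.enorm.pow_const _
      · exact hw.enorm.pow_const _)
    (by simp [Fin.sum_univ_four]; norm_num)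
    (by intro i _; fin_cases i <;> simp)
  simp only [Fin.prod_univ_four, Matrix.cons_val, ← ENNReal.rpow_mul] at key
  simp only [eLpNorm_eq_lintegral_rpow_enorm_toReal (p := 2) (by simp) (by simp),
    eLpNorm_eq_lintegral_rpow_enorm_toReal (p := 6) (by simp) (by simp), ENNReal.toReal_ofNat,
    ← ENNReal.rpow_mul]
  convert key using 3 with x
  · rw [← ENNReal.rpow_add_of_nonneg _ _ (by norm_num) (by norm_num)]
    norm_num
  all_goals norm_num

/-- The constant `K` bounds the triple products that make up the trilinear form. -/
def IsTripleConst (Ω : Set (Vec d)) (K : ℝ) : Prop :=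
  0 ≤ K ∧ ∀ (F : Type) [NormedAddCommGroup F] (a w : H10 Ω) (g : L2 Ω F),
    ∫⁻ x in Ω, ‖val a x‖ₑ * ‖g x‖ₑ * ‖val w x‖ₑ ≤
      ENNReal.ofReal (K * √‖val a‖ * √‖grad a‖ * ‖g‖ * ‖grad w‖)

/-- The middle factor may have any value type, since both ∇v and the scalar ∇ · χ are put there. -/
theorem exists_isTripleConst (hd : d = 2 ∨ d = 3) (hΩb : Bornology.IsBounded Ω) :
    ∃ K, IsTripleConst Ω K := by
  obtain ⟨C, hC⟩ := exists_eLpNorm_six_le hd hΩb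
  refine ⟨√C * C, by positivity, fun F _ a w g => ?_⟩
  refine (lintegral_enorm_mul_mul_le (Lp.aestronglyMeasurable _) (Lp.aestronglyMeasurable _)
    (Lp.aestronglyMeasurable _)).trans ?_
  have key : ‖val a‖ₑ ^ (1 / 2 : ℝ) * (C * ‖grad a‖ₑ) ^ (1 / 2 : ℝ) * ‖g‖ₑ * (C * ‖grad w‖ₑ) =
      ENNReal.ofReal (√C * C * √‖val a‖ * √‖grad a‖ * ‖g‖ * ‖grad w‖) := by
    rw [ENNReal.mul_rpow_of_nonneg _ _ (by norm_num)]
    have hs : ∀ r : ℝ, 0 ≤ r → ENNReal.ofReal r ^ (1 / 2 : ℝ) = ENNReal.ofReal √r := fun r hr => by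
      rw [ENNReal.ofReal_rpow_of_nonneg hr (by norm_num), Real.sqrt_eq_rpow]
    simp only [← ofReal_norm, ← ENNReal.ofReal_coe_nnreal, hs _ (norm_nonneg _),
      hs _ (NNReal.coe_nonneg _)]
    rw [← ENNReal.ofReal_mul (by positivity), ← ENNReal.ofReal_mul (by positivity),
      ← ENNReal.ofReal_mul (by positivity), ← ENNReal.ofReal_mul (by positivity),
      ← ENNReal.ofReal_mul (by positivity)]
    ring_nf
  rw [← key]
  gcongr
  · exact le_of_eq (Lp.enorm_def _).symm
  · exact hC a
  · exact le_of_eq (Lp.enorm_def _).symm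
  · exact hC w

/-- An integrand bounded by a triple product is integrable, with the corresponding bound. -/
theorem IsTripleConst.integrable_and_abs_integral_le {K : ℝ} (hK : IsTripleConst Ω K) {F : Type}
    [NormedAddCommGroup F] (a w : H10 Ω) (g : L2 Ω F) {h : Vec d → ℝ}
    (hm : AEStronglyMeasurable h (volume.restrict Ω))
    (hb : ∀ᵐ x ∂volume.restrict Ω, |h x| ≤ ‖val a x‖ * ‖g x‖ * ‖val w x‖) :
    Integrable h (volume.restrict Ω) ∧
      |∫ x in Ω, h x| ≤ K * √‖val a‖ * √‖grad a‖ * ‖g‖ * ‖grad w‖ := by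
  have hle : ∫⁻ x in Ω, ‖h x‖ₑ ≤
      ENNReal.ofReal (K * √‖val a‖ * √‖grad a‖ * ‖g‖ * ‖grad w‖) := by
    refine (lintegral_mono_ae ?_).trans (hK.2 F a w g)
    filter_upwards [hb] with x hx
    simp only [← ofReal_norm]
    rw [← ENNReal.ofReal_mul (by positivity), ← ENNReal.ofReal_mul (by positivity)]
    exact ENNReal.ofReal_le_ofReal hx
  refine ⟨⟨hm, hle.trans_lt ENNReal.ofReal_lt_top⟩, ?_⟩
  have h1 := enorm_integral_le_lintegral_enorm (μ := volume.restrict Ω) h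
  have := hK.1
  rw [← Real.norm_eq_abs, ← ENNReal.ofReal_le_ofReal_iff (by positivity), ofReal_norm]
  exact h1.trans hle

theorem aestronglyMeasurable_conv (χ v w : H10 Ω) : AEStronglyMeasurable
    (fun x => ∑ i : Fin d, ∑ j : Fin d, val χ x j * grad v x (i, j) * val w x i)
    (volume.restrict Ω) := by
  have h1 := (Lp.aestronglyMeasurable (val χ)).aemeasurable
  have h2 := (Lp.aestronglyMeasurable (grad v)).aemeasurable
  have h3 := (Lp.aestronglyMeasurable (val w)).aemeasurable
  refine AEMeasurable.aestronglyMeasurable ?_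
  refine Finset.aemeasurable_fun_sum _ fun i _ => Finset.aemeasurable_fun_sum _ fun j _ => ?_
  exact (((EuclideanSpace.proj j).continuous.measurable.comp_aemeasurable h1).mul
    ((EuclideanSpace.proj (i, j)).continuous.measurable.comp_aemeasurable h2)).mul
    ((EuclideanSpace.proj i).continuous.measurable.comp_aemeasurable h3)

theorem IsTripleConst.integrable_conv {K : ℝ} (hK : IsTripleConst Ω K) (χ v w : H10 Ω) :
    Integrable (fun x => ∑ i : Fin d, ∑ j : Fin d, val χ x j * grad v x (i, j) * val w x i)
      (volume.restrict Ω) :=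
  (hK.integrable_and_abs_integral_le χ w (grad v) (aestronglyMeasurable_conv χ v w)
    (Filter.Eventually.of_forall fun _ => abs_sum_sum_le _ _ _)).1

theorem IsTripleConst.abs_conv_le_left {K : ℝ} (hK : IsTripleConst Ω K) (χ v w : H10 Ω) :
    |conv χ v w| ≤ K * √‖val χ‖ * √‖grad χ‖ * ‖grad v‖ * ‖grad w‖ :=
  (hK.integrable_and_abs_integral_le χ w (grad v) (aestronglyMeasurable_conv χ v w)
    (Filter.Eventually.of_forall fun _ => abs_sum_sum_le _ _ _)).2

theorem IsTripleConst.abs_conv_le_right {K : ℝ} (hK : IsTripleConst Ω K) (χ v w : H10 Ω) :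
    |conv χ v w| ≤ K * √‖val w‖ * √‖grad w‖ * ‖grad v‖ * ‖grad χ‖ :=
  (hK.integrable_and_abs_integral_le w χ (grad v) (aestronglyMeasurable_conv χ v w)
    (Filter.Eventually.of_forall fun _ => (abs_sum_sum_le _ _ _).trans_eq (by ring))).2

theorem IsTripleConst.conv_add_left {K : ℝ} (hK : IsTripleConst Ω K) (χ χ' v w : H10 Ω) :
    conv (χ + χ') v w = conv χ v w + conv χ' v w := by
  rw [conv, conv, conv, ← integral_add (hK.integrable_conv _ _ _) (hK.integrable_conv _ _ _)]
  refine integral_congr_ae ?_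
  filter_upwards [Lp.coeFn_add (val χ) (val χ')] with x hx
  simp only [val_add, hx, Pi.add_apply, PiLp.add_apply, ← Finset.sum_add_distrib, add_mul]

theorem IsTripleConst.conv_add_mid {K : ℝ} (hK : IsTripleConst Ω K) (χ v v' w : H10 Ω) :
    conv χ (v + v') w = conv χ v w + conv χ v' w := by
  rw [conv, conv, conv, ← integral_add (hK.integrable_conv _ _ _) (hK.integrable_conv _ _ _)]
  refine integral_congr_ae ?_
  filter_upwards [Lp.coeFn_add (grad v) (grad v')] with x hx
  simp only [grad_add, hx, Pi.add_apply, PiLp.add_apply, ← Finset.sum_add_distrib, add_mul,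
    mul_add]

theorem IsTripleConst.conv_add_right {K : ℝ} (hK : IsTripleConst Ω K) (χ v w w' : H10 Ω) :
    conv χ v (w + w') = conv χ v w + conv χ v w' := by
  rw [conv, conv, conv, ← integral_add (hK.integrable_conv _ _ _) (hK.integrable_conv _ _ _)]
  refine integral_congr_ae ?_
  filter_upwards [Lp.coeFn_add (val w) (val w')] with x hx
  simp only [val_add, hx, Pi.add_apply, PiLp.add_apply, ← Finset.sum_add_distrib, mul_add]

theorem conv_smul_left (c : ℝ) (χ v w : H10 Ω) : conv (c • χ) v w = c * conv χ v w := by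
  rw [conv, conv, ← integral_const_mul]
  refine integral_congr_ae ?_
  filter_upwards [Lp.coeFn_smul c (val χ)] with x hx
  simp only [val_smul, hx, Pi.smul_apply, PiLp.smul_apply, Finset.mul_sum, smul_eq_mul, mul_assoc]

theorem conv_smul_mid (c : ℝ) (χ v w : H10 Ω) : conv χ (c • v) w = c * conv χ v w := by
  rw [conv, conv, ← integral_const_mul]
  refine integral_congr_ae ?_
  filter_upwards [Lp.coeFn_smul c (grad v)] with x hx
  simp only [grad_smul, hx, Pi.smul_apply, PiLp.smul_apply, Finset.mul_sum, smul_eq_mul]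
  exact Finset.sum_congr rfl fun i _ => Finset.sum_congr rfl fun j _ => by ring

theorem conv_smul_right (c : ℝ) (χ v w : H10 Ω) : conv χ v (c • w) = c * conv χ v w := by
  rw [conv, conv, ← integral_const_mul]
  refine integral_congr_ae ?_
  filter_upwards [Lp.coeFn_smul c (val w)] with x hx
  simp only [val_smul, hx, Pi.smul_apply, PiLp.smul_apply, Finset.mul_sum, smul_eq_mul]
  exact Finset.sum_congr rfl fun i _ => Finset.sum_congr rfl fun j _ => by ring

/-- The form `((∇ · χ) v, w)`. -/
noncomputable def diveForm (χ v w : H10 Ω) : ℝ :=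
  ∫ x in Ω, dive χ x * inner ℝ (val v x) (val w x)

theorem aestronglyMeasurable_diveForm (χ v w : H10 Ω) : AEStronglyMeasurable
    (fun x => dive χ x * inner ℝ (val v x) (val w x)) (volume.restrict Ω) :=
  (Lp.aestronglyMeasurable (dive χ)).mul
    ((Lp.aestronglyMeasurable (val v)).inner (Lp.aestronglyMeasurable (val w)))

theorem IsTripleConst.integrable_and_abs_diveForm_le {K : ℝ} (hK : IsTripleConst Ω K)
    (χ v w : H10 Ω) :
    Integrable (fun x => dive χ x * inner ℝ (val v x) (val w x)) (volume.restrict Ω) ∧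
      |diveForm χ v w| ≤ K * √‖val v‖ * √‖grad v‖ * ‖dive χ‖ * ‖grad w‖ := by
  refine hK.integrable_and_abs_integral_le v w (dive χ) (aestronglyMeasurable_diveForm χ v w)
    (Filter.Eventually.of_forall fun x => ?_)
  rw [abs_mul, mul_comm ‖val v x‖, mul_assoc, Real.norm_eq_abs]
  gcongr
  exact abs_real_inner_le_norm _ _

theorem IsTripleConst.diveForm_add_left {K : ℝ} (hK : IsTripleConst Ω K) (χ χ' v w : H10 Ω) :
    diveForm (χ + χ') v w = diveForm χ v w + diveForm χ' v w := by
  rw [diveForm, diveForm, diveForm, ← integral_add (hK.integrable_and_abs_diveForm_le _ _ _).1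
    (hK.integrable_and_abs_diveForm_le _ _ _).1]
  refine integral_congr_ae ?_
  filter_upwards [Lp.coeFn_add (dive χ) (dive χ')] with x hx
  simp only [dive_add, hx, Pi.add_apply, add_mul]

theorem IsTripleConst.diveForm_add_mid {K : ℝ} (hK : IsTripleConst Ω K) (χ v v' w : H10 Ω) :
    diveForm χ (v + v') w = diveForm χ v w + diveForm χ v' w := by
  rw [diveForm, diveForm, diveForm, ← integral_add (hK.integrable_and_abs_diveForm_le _ _ _).1
    (hK.integrable_and_abs_diveForm_le _ _ _).1]
  refine integral_congr_ae ?_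
  filter_upwards [Lp.coeFn_add (val v) (val v')] with x hx
  simp only [val_add, hx, Pi.add_apply, inner_add_left, mul_add]

theorem diveForm_comm (χ v w : H10 Ω) : diveForm χ v w = diveForm χ w v := by
  simp only [diveForm, real_inner_comm]

theorem diveForm_smul_left (c : ℝ) (χ v w : H10 Ω) :
    diveForm (c • χ) v w = c * diveForm χ v w := by
  rw [diveForm, diveForm, ← integral_const_mul]
  refine integral_congr_ae ?_
  filter_upwards [Lp.coeFn_smul c (dive χ)] with x hx
  simp only [dive_smul, hx, Pi.smul_apply, smul_eq_mul, mul_assoc]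

theorem diveForm_smul_mid (c : ℝ) (χ v w : H10 Ω) :
    diveForm χ (c • v) w = c * diveForm χ v w := by
  rw [diveForm, diveForm, ← integral_const_mul]
  refine integral_congr_ae ?_
  filter_upwards [Lp.coeFn_smul c (val v)] with x hx
  simp only [val_smul, hx, Pi.smul_apply, real_inner_smul_left]
  ring

/-! ### Integration by parts for test fields and its extension by density. -/

section calculus

variable {E : Type*} [NormedAddCommGroup E] [NormedSpace ℝ E]
  [MeasurableSpace E] [BorelSpace E] {m : Measure E} [m.IsAddHaarMeasure]

theorem integrable_fderiv_apply {h : E → ℝ} (h1 : ContDiff ℝ 1 h) (h2 : HasCompactSupport h)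
    (v : E) : Integrable (fun x => fderiv ℝ h x v) m :=
  ((h1.continuous_fderiv one_ne_zero).clm_apply continuous_const).integrable_of_hasCompactSupport
    (h2.fderiv_apply ℝ v)

variable [FiniteDimensional ℝ E]

theorem integral_fderiv_apply_eq_zero {h : E → ℝ} (h1 : ContDiff ℝ 1 h)
    (h2 : HasCompactSupport h) (v : E) : ∫ x, fderiv ℝ h x v ∂m = 0 := by
  have := integral_mul_fderiv_eq_neg_fderiv_mul_of_integrable (μ := m) (f := fun _ : E => (1 : ℝ))
    (g := h) (v := v) (by simp) (by simpa using integrable_fderiv_apply h1 h2 v)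
    (by simpa using h1.continuous.integrable_of_hasCompactSupport h2)
    (fun x _ => differentiableAt_const _) (fun x _ => h1.differentiable one_ne_zero x)
  simpa using this

/-- Moving the derivative off a leaves a second derivative of c, which is symmetric. -/
theorem integral_fderiv_mul_fderiv_comm {a c : E → ℝ} (ha : ContDiff ℝ 2 a)
    (ha' : HasCompactSupport a) (hc : ContDiff ℝ 2 c) (v w : E) :
    ∫ x, fderiv ℝ a x v * fderiv ℝ c x w ∂m = ∫ x, fderiv ℝ a x w * fderiv ℝ c x v ∂m := by
  have hc1 : ∀ u : E, ContDiff ℝ 1 fun x => fderiv ℝ c x u := fun u =>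
    (hc.fderiv_right (m := 1) (by norm_num)).clm_apply contDiff_const
  have hac : Continuous (fderiv ℝ a) := ha.continuous_fderiv two_ne_zero
  have key : ∀ v w : E, ∫ x, fderiv ℝ a x v * fderiv ℝ c x w ∂m =
      -∫ x, a x * fderiv ℝ (fderiv ℝ c) x v w ∂m := fun v w => by
    have hd : ∀ x, fderiv ℝ (fun y => fderiv ℝ c y w) x v = fderiv ℝ (fderiv ℝ c) x v w :=
      fun x => by
        rw [fderiv_clm_apply ((hc.fderiv_right (m := 1) (by norm_num)).differentiable
          one_ne_zero x) (differentiableAt_const _)]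
        simp
    have := integral_mul_fderiv_eq_neg_fderiv_mul_of_integrable (μ := m) (f := a)
      (g := fun x => fderiv ℝ c x w) (v := v)
      (((hac.clm_apply continuous_const).mul (hc1 w).continuous).integrable_of_hasCompactSupport
        (ha'.fderiv_apply ℝ v).mul_right)
      ((ha.continuous.mul (((hc1 w).continuous_fderiv one_ne_zero).clm_apply
        continuous_const)).integrable_of_hasCompactSupport ha'.mul_right)
      ((ha.continuous.mul (hc1 w).continuous).integrable_of_hasCompactSupport ha'.mul_right)
      (fun x _ => ha.differentiable two_ne_zero x)
      (fun x _ => (hc1 w).differentiable one_ne_zero x)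
    simp only [hd] at this
    rw [this, neg_neg]
  rw [key, key]
  congr 2 with x
  rw [(hc.contDiffAt (x := x)).isSymmSndFDerivAt (by simp) v w]

end calculus

theorem IsTest.contDiff_coord {φ : Vec d → Vec d} {v : H10 Ω} (h : IsTest φ v) (i : Fin d) :
    ContDiff ℝ ∞ fun y => φ y i :=
  (EuclideanSpace.proj i : Vec d →L[ℝ] ℝ).contDiff.comp h.contDiff

theorem IsTest.hasCompactSupport_coord {φ : Vec d → Vec d} {v : H10 Ω} (h : IsTest φ v)
    (i : Fin d) : HasCompactSupport fun y => φ y i :=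
  h.hasCompactSupport.comp_left (g := fun z : Vec d => z i) rfl

theorem IsTest.jac_apply {φ : Vec d → Vec d} {v : H10 Ω} (h : IsTest φ v) (x : Vec d)
    (i j : Fin d) :
    jac φ x (i, j) = fderiv ℝ (fun y => φ y i) x (EuclideanSpace.single j 1) :=
  CDAIPY.jac_apply (h.contDiff.differentiable (by simp)) x i j

theorem IsTest.jac_eq_zero {φ : Vec d → Vec d} {v : H10 Ω} (h : IsTest φ v) {x : Vec d}
    (hx : x ∉ Ω) : jac φ x = 0 := by
  ext ij
  simp [jac, fderiv_of_notMem_tsupport (𝕜 := ℝ) (f := φ) fun h' => hx (h.tsupport_subset h')]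

theorem IsTest.integrable_jac_mul_jac {φ : Vec d → Vec d} {v : H10 Ω} (h : IsTest φ v)
    (i j k l : Fin d) : Integrable fun x => jac φ x (i, j) * jac φ x (k, l) := by
  have hc : ∀ i j, Continuous fun x => jac φ x (i, j) := fun i j => by
    simp only [h.jac_apply]
    exact ((h.contDiff_coord i).continuous_fderiv (by simp)).clm_apply continuous_const
  refine ((hc i j).mul (hc k l)).integrable_of_hasCompactSupport (HasCompactSupport.mul_right ?_)
  simp only [h.jac_apply]
  exact (h.hasCompactSupport_coord i).fderiv_apply ℝ _

theorem IsTest.integral_jac_mul_jac {φ : Vec d → Vec d} {v : H10 Ω} (h : IsTest φ v)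
    (i j : Fin d) :
    ∫ x, jac φ x (i, i) * jac φ x (j, j) = ∫ x, jac φ x (i, j) * jac φ x (j, i) := by
  simp only [h.jac_apply]
  exact integral_fderiv_mul_fderiv_comm (contDiff_infty.1 (h.contDiff_coord i) 2)
    (h.hasCompactSupport_coord i) (contDiff_infty.1 (h.contDiff_coord j) 2) _ _

theorem norm_sq_eq_integral {F : Type} [NormedAddCommGroup F] [InnerProductSpace ℝ F]
    (g : L2 Ω F) : ‖g‖ ^ 2 = ∫ x in Ω, ‖g x‖ ^ 2 := by
  rw [← real_inner_self_eq_norm_sq, L2.inner_def]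
  simp

/-- The constant is 1 rather than √d: integrating by parts twice turns ∂ᵢφᵢ ∂ⱼφⱼ into ∂ⱼφᵢ ∂ᵢφⱼ, and
then 2ab ≤ a² + b² applies to each pair of entries. -/
theorem norm_dive_le (v : H10 Ω) : ‖dive v‖ ≤ ‖grad v‖ := by
  refine induction_of_test (isClosed_le continuous_dive.norm continuous_grad.norm)
    (fun φ v h => ?_) v
  refine abs_le_of_sq_le_sq' ?_ (norm_nonneg _) |>.2
  have h1 : ‖dive v‖ ^ 2 = ∫ x, ∑ i, ∑ j, jac φ x (i, i) * jac φ x (j, j) := by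
    rw [norm_sq_eq_integral (dive v)]
    refine Eq.trans ?_ (setIntegral_eq_integral_of_forall_compl_eq_zero (s := Ω) ?_)
    · refine integral_congr_ae ?_
      filter_upwards [dive_ae v, h.grad_ae] with x hx hx'
      rw [hx, hx', Real.norm_eq_abs, sq_abs, sq, Finset.sum_mul_sum]
    · intro x hx
      simp [h.jac_eq_zero hx]
  have h2 : ‖grad v‖ ^ 2 = ∫ x, ∑ i, ∑ j, jac φ x (i, j) * jac φ x (i, j) := by
    rw [norm_sq_eq_integral (grad v)]
    refine Eq.trans ?_ (setIntegral_eq_integral_of_forall_compl_eq_zero (s := Ω) ?_)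
    · refine integral_congr_ae ?_
      filter_upwards [h.grad_ae] with x hx
      rw [hx, EuclideanSpace.norm_sq_eq, Fintype.sum_prod_type]
      simp [sq]
    · intro x hx
      simp [h.jac_eq_zero hx]
  have h3 : ∫ x, ∑ i, ∑ j, jac φ x (i, i) * jac φ x (j, j) =
      ∫ x, ∑ i, ∑ j, jac φ x (i, j) * jac φ x (j, i) := by
    rw [integral_finsetSum _ fun i _ => integrable_finsetSum _ fun j _ =>
        h.integrable_jac_mul_jac i i j j, integral_finsetSum _ fun i _ =>
        integrable_finsetSum _ fun j _ => h.integrable_jac_mul_jac i j j i]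
    refine Finset.sum_congr rfl fun i _ => ?_
    rw [integral_finsetSum _ fun j _ => h.integrable_jac_mul_jac i i j j,
      integral_finsetSum _ fun j _ => h.integrable_jac_mul_jac i j j i]
    exact Finset.sum_congr rfl fun j _ => h.integral_jac_mul_jac i j
  rw [h1, h2, h3]
  refine integral_mono
    (integrable_finsetSum _ fun _ _ => integrable_finsetSum _ fun _ _ =>
      h.integrable_jac_mul_jac _ _ _ _)
    (integrable_finsetSum _ fun _ _ => integrable_finsetSum _ fun _ _ =>
      h.integrable_jac_mul_jac _ _ _ _) fun x => ?_
  have hs : ∑ i, ∑ j, jac φ x (j, i) * jac φ x (j, i) =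
      ∑ i, ∑ j, jac φ x (i, j) * jac φ x (i, j) := Finset.sum_comm
  have hle : 2 * ∑ i, ∑ j, jac φ x (i, j) * jac φ x (j, i) ≤
      ∑ i, ∑ j, jac φ x (i, j) * jac φ x (i, j) +
        ∑ i, ∑ j, jac φ x (j, i) * jac φ x (j, i) := by
    simp only [Finset.mul_sum, ← Finset.sum_add_distrib]
    refine Finset.sum_le_sum fun i _ => Finset.sum_le_sum fun j _ => ?_
    nlinarith [sq_nonneg (jac φ x (i, j) - jac φ x (j, i))]
  linarith

/-- Integration by parts in the convection term, for test functions. -/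
theorem IsTripleConst.conv_add_conv_add_diveForm_of_test {K : ℝ} (hK : IsTripleConst Ω K)
    {φ ψ η : Vec d → Vec d} {χ v w : H10 Ω} (hφ : IsTest φ χ) (hψ : IsTest ψ v)
    (hη : IsTest η w) : conv χ v w + conv χ w v + diveForm χ v w = 0 := by
  -- The three integrands together are ∑ ∂ⱼ(φⱼ ψᵢ ηᵢ), and derivatives of compactly supported
  -- functions integrate to zero.
  let g : Fin d → Fin d → Vec d → ℝ := fun i j y => φ y j * (ψ y i * η y i)
  have hg1 : ∀ i j, ContDiff ℝ 1 (g i j) := fun i j =>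
    ((hφ.contDiff_coord j).mul ((hψ.contDiff_coord i).mul (hη.contDiff_coord i))).of_le (by simp)
  have hg2 : ∀ i j, HasCompactSupport (g i j) := fun i j =>
    (hφ.hasCompactSupport_coord j).mul_right
  have hder : ∀ i j x, fderiv ℝ (g i j) x (EuclideanSpace.single j 1) =
      φ x j * jac ψ x (i, j) * η x i + φ x j * jac η x (i, j) * ψ x i +
        jac φ x (j, j) * (ψ x i * η x i) := fun i j x => by
    have e1 := ((hφ.contDiff_coord j).differentiable (by simp) x).hasFDerivAt
    have e2 := ((hψ.contDiff_coord i).differentiable (by simp) x).hasFDerivAt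
    have e3 := ((hη.contDiff_coord i).differentiable (by simp) x).hasFDerivAt
    have e4 : HasFDerivAt (g i j) _ x := e1.mul (e2.mul e3)
    rw [hφ.jac_apply, hψ.jac_apply, hη.jac_apply, e4.fderiv]
    simp
    ring
  have h0 : ∫ x, ∑ i, ∑ j, fderiv ℝ (g i j) x (EuclideanSpace.single j 1) = 0 := by
    have hi : ∀ i j, Integrable fun x => fderiv ℝ (g i j) x (EuclideanSpace.single j 1) :=
      fun i j => integrable_fderiv_apply (hg1 i j) (hg2 i j) _
    rw [integral_finsetSum _ fun i _ => integrable_finsetSum _ fun j _ => hi i j]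
    refine Finset.sum_eq_zero fun i _ => ?_
    rw [integral_finsetSum _ fun j _ => hi i j]
    exact Finset.sum_eq_zero fun j _ => integral_fderiv_apply_eq_zero (hg1 i j) (hg2 i j) _
  rw [← h0, conv, conv, diveForm, ← integral_add (hK.integrable_conv _ _ _)
    (hK.integrable_conv _ _ _), ← integral_add (by
      exact (hK.integrable_conv χ v w).add (hK.integrable_conv χ w v))
    (hK.integrable_and_abs_diveForm_le _ _ _).1]
  refine Eq.trans ?_ (setIntegral_eq_integral_of_forall_compl_eq_zero (s := Ω) ?_)
  · refine integral_congr_ae ?_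
    filter_upwards [hφ.val_ae, hψ.val_ae, hη.val_ae, hψ.grad_ae, hη.grad_ae, hφ.grad_ae,
      dive_ae χ] with x e1 e2 e3 e4 e5 e6 e7
    simp only [hder, e1, e2, e3, e4, e5, e6, e7, Finset.sum_add_distrib]
    congr 1
    rw [Finset.sum_comm, Finset.sum_mul]
    refine Finset.sum_congr rfl fun i _ => ?_
    rw [← Finset.mul_sum, PiLp.inner_apply]
    simp [mul_comm]
  · intro x hx
    have : φ x = 0 := image_eq_zero_of_notMem_tsupport fun h' => hx (hφ.tsupport_subset h')
    simp [hder, this, hφ.jac_eq_zero hx]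

theorem continuous_of_add_of_smul_of_bound {F : H10 Ω → ℝ} (hadd : ∀ v w, F (v + w) = F v + F w)
    (hsmul : ∀ (c : ℝ) v, F (c • v) = c * F v) (C : ℝ) (hb : ∀ v, |F v| ≤ C * ‖v‖) :
    Continuous F :=
  (LinearMap.mkContinuous (⟨⟨F, hadd⟩, hsmul⟩ : H10 Ω →ₗ[ℝ] ℝ) C hb).continuous

theorem sqrt_val_mul_sqrt_grad_le (v : H10 Ω) : √‖val v‖ * √‖grad v‖ ≤ ‖v‖ := by
  rw [← Real.sqrt_mul (norm_nonneg _)]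
  refine Real.sqrt_le_iff.2 ⟨norm_nonneg _, ?_⟩
  rw [sq]
  exact mul_le_mul (norm_val_le v) (norm_grad_le v) (norm_nonneg _) (norm_nonneg _)

theorem IsTripleConst.abs_conv_le {K : ℝ} (hK : IsTripleConst Ω K) (χ v w : H10 Ω) :
    |conv χ v w| ≤ K * ‖χ‖ * ‖v‖ * ‖w‖ := by
  have := hK.1
  refine (hK.abs_conv_le_left χ v w).trans ?_
  rw [mul_assoc K]
  gcongr
  · exact sqrt_val_mul_sqrt_grad_le χ
  · exact norm_grad_le v
  · exact norm_grad_le w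

theorem IsTripleConst.abs_diveForm_le {K : ℝ} (hK : IsTripleConst Ω K) (χ v w : H10 Ω) :
    |diveForm χ v w| ≤ K * ‖v‖ * ‖χ‖ * ‖w‖ := by
  have := hK.1
  refine (hK.integrable_and_abs_diveForm_le χ v w).2.trans ?_
  rw [mul_assoc K]
  gcongr
  · exact sqrt_val_mul_sqrt_grad_le v
  · exact (norm_dive_le χ).trans (norm_grad_le χ)
  · exact norm_grad_le w

/-- Integration by parts in the convection term. -/
theorem IsTripleConst.conv_add_conv_add_diveForm {K : ℝ} (hK : IsTripleConst Ω K)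
    (χ v w : H10 Ω) : conv χ v w + conv χ w v + diveForm χ v w = 0 := by
  have c1 : ∀ v w : H10 Ω, Continuous fun χ => conv χ v w := fun v w =>
    continuous_of_add_of_smul_of_bound (fun _ _ => hK.conv_add_left _ _ _ _)
      (fun _ _ => conv_smul_left _ _ _ _) (K * ‖v‖ * ‖w‖)
      fun χ => (hK.abs_conv_le χ v w).trans_eq (by ring)
  have c2 : ∀ χ w : H10 Ω, Continuous fun v => conv χ v w := fun χ w =>
    continuous_of_add_of_smul_of_bound (fun _ _ => hK.conv_add_mid _ _ _ _)
      (fun _ _ => conv_smul_mid _ _ _ _) (K * ‖χ‖ * ‖w‖)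
      fun v => (hK.abs_conv_le χ v w).trans_eq (by ring)
  have c3 : ∀ χ v : H10 Ω, Continuous fun w => conv χ v w := fun χ v =>
    continuous_of_add_of_smul_of_bound (fun _ _ => hK.conv_add_right _ _ _ _)
      (fun _ _ => conv_smul_right _ _ _ _) (K * ‖χ‖ * ‖v‖)
      fun w => (hK.abs_conv_le χ v w).trans_eq (by ring)
  have d1 : ∀ v w : H10 Ω, Continuous fun χ => diveForm χ v w := fun v w =>
    continuous_of_add_of_smul_of_bound (fun _ _ => hK.diveForm_add_left _ _ _ _)
      (fun _ _ => diveForm_smul_left _ _ _ _) (K * ‖v‖ * ‖w‖)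
      fun χ => (hK.abs_diveForm_le χ v w).trans_eq (by ring)
  have d2 : ∀ χ w : H10 Ω, Continuous fun v => diveForm χ v w := fun χ w =>
    continuous_of_add_of_smul_of_bound (fun _ _ => hK.diveForm_add_mid _ _ _ _)
      (fun _ _ => diveForm_smul_mid _ _ _ _) (K * ‖χ‖ * ‖w‖)
      fun v => (hK.abs_diveForm_le χ v w).trans_eq (by ring)
  have d3 : ∀ χ v : H10 Ω, Continuous fun w => diveForm χ v w := fun χ v => by
    simp only [diveForm_comm χ v]
    exact d2 χ v
  -- The arguments are replaced by test fields one at a time, so continuity in each separate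
  -- argument is enough.
  refine induction_of_test (P := fun χ => ∀ v w, conv χ v w + conv χ w v + diveForm χ v w = 0)
    ?_ (fun φ χ hφ => ?_) χ v w
  · simp only [Set.ofPred_forall]
    exact isClosed_iInter fun v => isClosed_iInter fun w =>
      isClosed_eq (((c1 v w).add (c1 w v)).add (d1 v w)) continuous_const
  intro v
  refine induction_of_test (P := fun v => ∀ w, conv χ v w + conv χ w v + diveForm χ v w = 0)
    ?_ (fun ψ v hψ => ?_) v
  · simp only [Set.ofPred_forall]
    exact isClosed_iInter fun w =>
      isClosed_eq (((c2 χ w).add (c3 χ w)).add (d2 χ w)) continuous_const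
  refine induction_of_test (P := fun w => conv χ v w + conv χ w v + diveForm χ v w = 0)
    ?_ (fun η w hη => ?_)
  · exact isClosed_eq (((c3 χ v).add (c2 χ v)).add (d3 χ v)) continuous_const
  · exact hK.conv_add_conv_add_diveForm_of_test hφ hψ hη

theorem exists_isTrilinearConst (hd : d = 2 ∨ d = 3) (hΩb : Bornology.IsBounded Ω) :
    ∃ M : ℝ, IsTrilinearConst Ω M := by
  obtain ⟨K, hK⟩ := exists_isTripleConst (Ω := Ω) hd hΩb
  obtain ⟨CP, hCP0, hCP⟩ := exists_isPoincareConst (Ω := Ω) hd hΩb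
  have hK0 := hK.1
  have hb1 : ∀ χ v w : H10 Ω, b χ v w ≤ K * √‖val χ‖ * √‖grad χ‖ * ‖grad v‖ * ‖grad w‖ :=
    fun χ v w => by
      have h1 := (le_abs_self _).trans (hK.abs_conv_le_left χ v w)
      have h2 := (neg_le_abs _).trans (hK.abs_conv_le_left χ w v)
      rw [b]
      linarith
  have hb2 : ∀ χ v w : H10 Ω,
      b χ v w ≤ 2 * K * ‖grad χ‖ * √‖val v‖ * √‖grad v‖ * ‖grad w‖ := fun χ v w => by
    -- Half powers of v require that v not be differentiated in full: integration by parts gives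
    -- b(χ, v, w) = -(χ · ∇w, v) - ½((∇ · χ)v, w).
    have h1 := (neg_le_abs _).trans (hK.abs_conv_le_right χ w v)
    have h2 := (neg_le_abs _).trans (hK.integrable_and_abs_diveForm_le χ v w).2
    have h3 := hK.conv_add_conv_add_diveForm χ v w
    have h4 : K * √‖val v‖ * √‖grad v‖ * ‖dive χ‖ * ‖grad w‖ ≤
        K * √‖val v‖ * √‖grad v‖ * ‖grad χ‖ * ‖grad w‖ := by
      gcongr
      exact norm_dive_le χ
    have h5 : 0 ≤ K * √‖val v‖ * √‖grad v‖ * ‖grad χ‖ * ‖grad w‖ := by positivity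
    rw [b]
    linarith
  have hb3 : ∀ χ v w : H10 Ω, b χ v w ≤ K * √CP * ‖grad χ‖ * ‖grad v‖ * ‖grad w‖ :=
    fun χ v w => by
      have h : √‖val χ‖ * √‖grad χ‖ ≤ √CP * ‖grad χ‖ := by
        rw [← Real.sqrt_mul (norm_nonneg _)]
        refine Real.sqrt_le_iff.2 ⟨by positivity, ?_⟩
        rw [mul_pow, Real.sq_sqrt hCP0.le, sq, ← mul_assoc]
        gcongr
        exact hCP χ
      refine (hb1 χ v w).trans ?_
      rw [mul_assoc K √‖val χ‖, mul_assoc K √CP]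
      gcongr
  have e1 : K ≤ 2 * K + K * √CP + 1 := by nlinarith [mul_nonneg hK0 (Real.sqrt_nonneg CP)]
  have e2 : 2 * K ≤ 2 * K + K * √CP + 1 := by nlinarith [mul_nonneg hK0 (Real.sqrt_nonneg CP)]
  have e3 : K * √CP ≤ 2 * K + K * √CP + 1 := by linarith
  refine ⟨2 * K + K * √CP + 1, by positivity, fun χ v w =>
    ⟨(hb1 χ v w).trans ?_, (hb2 χ v w).trans ?_, (hb3 χ v w).trans ?_⟩⟩ <;> gcongr

/-! ### The dual norm, and the algebra and two-sided bounds of b. -/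

theorem le_dualNorm_mul {CP : ℝ} (hCP : IsPoincareConst Ω CP) (f : H10 Ω →L[ℝ] ℝ) (v : H10 Ω) :
    f v ≤ dualNorm f * ‖grad v‖ := by
  -- A real supremum is meaningful only for a bounded family; Poincaré's inequality supplies the
  -- bound.
  have hnorm : ∀ v : H10 Ω, ‖v‖ ≤ max CP 1 * ‖grad v‖ := fun v =>
    max_le ((hCP.2 v).trans (by gcongr; exact le_max_left _ _))
      (le_mul_of_one_le_left (norm_nonneg _) (le_max_right _ _))
  have hf : ∀ v : H10 Ω, f v ≤ ‖f‖ * max CP 1 * ‖grad v‖ := fun v =>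
    (le_abs_self _).trans ((f.le_opNorm v).trans (by rw [mul_assoc]; gcongr; exact hnorm v))
  rcases (norm_nonneg (grad v)).eq_or_lt with h | h
  · have := hf v
    rw [← h] at this ⊢
    simpa using this
  · rw [← div_le_iff₀ h]
    refine le_ciSup (f := fun v : H10 Ω => f v / ‖grad v‖) ⟨‖f‖ * max CP 1, ?_⟩ v
    rintro _ ⟨v, rfl⟩
    exact div_le_of_le_mul₀ (norm_nonneg _)
      (mul_nonneg f.opNorm_nonneg (hCP.1.le.trans (le_max_left _ _))) (hf v)

theorem dualNorm_nonneg (f : H10 Ω →L[ℝ] ℝ) : 0 ≤ dualNorm f := by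
  by_cases h : BddAbove (Set.range fun v : H10 Ω => f v / ‖grad v‖)
  · exact (le_of_eq (by simp)).trans (le_ciSup h 0)
  · exact (Real.iSup_of_not_bddAbove h).ge

theorem b_self (χ v : H10 Ω) : b χ v v = 0 := sub_self _

theorem IsTripleConst.b_sub_left {K : ℝ} (hK : IsTripleConst Ω K) (χ χ' v w : H10 Ω) :
    b (χ - χ') v w = b χ v w - b χ' v w := by
  have h1 := hK.conv_add_left (χ - χ') χ' v w
  have h2 := hK.conv_add_left (χ - χ') χ' w v
  rw [sub_add_cancel] at h1 h2
  simp only [b, h1, h2]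
  ring

theorem IsTripleConst.b_sub_mid {K : ℝ} (hK : IsTripleConst Ω K) (χ v v' w : H10 Ω) :
    b χ (v - v') w = b χ v w - b χ v' w := by
  have h1 := hK.conv_add_mid χ (v - v') v' w
  have h2 := hK.conv_add_right χ w (v - v') v'
  rw [sub_add_cancel] at h1 h2
  simp only [b, h1, h2]
  ring

theorem IsTripleConst.b_add_right {K : ℝ} (hK : IsTripleConst Ω K) (χ v w w' : H10 Ω) :
    b χ v (w + w') = b χ v w + b χ v w' := by
  simp only [b, hK.conv_add_right, hK.conv_add_mid]
  ring

theorem b_neg_right (χ v w : H10 Ω) : b χ v (-w) = -b χ v w := by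
  rw [← neg_one_smul ℝ w]
  simp only [b, conv_smul_right, conv_smul_mid]
  ring

theorem IsTrilinearConst.abs_b_le_left {M : ℝ} (hM : IsTrilinearConst Ω M) (χ v w : H10 Ω) :
    |b χ v w| ≤ M * √‖val χ‖ * √‖grad χ‖ * ‖grad v‖ * ‖grad w‖ := by
  refine abs_le'.2 ⟨(hM.2 χ v w).1, ?_⟩
  simpa [b_neg_right, grad_neg] using (hM.2 χ v (-w)).1

theorem IsTrilinearConst.abs_b_le_mid {M : ℝ} (hM : IsTrilinearConst Ω M) (χ v w : H10 Ω) :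
    |b χ v w| ≤ M * ‖grad χ‖ * √‖val v‖ * √‖grad v‖ * ‖grad w‖ := by
  refine abs_le'.2 ⟨(hM.2 χ v w).2.1, ?_⟩
  simpa [b_neg_right, grad_neg] using (hM.2 χ v (-w)).2.1

/-- Young's inequality in the form ag ≤ a²/c + cg²/4 = c(a²/c² + g²/4). This is the source of the
factor H in the contraction rate. -/
theorem mul_sqrt_mul_sqrt_le {ν τ c a g y : ℝ} (hν : 0 < ν) (hc : 0 < c) (ha : 0 ≤ a)
    (hg : 0 ≤ g) (hy0 : 0 ≤ y) (hy : y ≤ ν * τ) :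
    y * (√a * √g) ≤ √ν * √(τ ^ 2 * c * (ν / c ^ 2 * a ^ 2 + ν / 4 * g ^ 2)) := by
  rw [← Real.sqrt_mul ha, ← Real.sqrt_mul hν.le]
  refine Real.le_sqrt_of_sq_le ?_
  rw [mul_pow, Real.sq_sqrt (by positivity)]
  calc y ^ 2 * (a * g) ≤ (ν * τ) ^ 2 * (a ^ 2 / c + c * g ^ 2 / 4) := by
        gcongr
        have : 0 ≤ c * (a / c - g / 2) ^ 2 := by positivity
        have h2 : c * (a / c - g / 2) ^ 2 = a ^ 2 / c + c * g ^ 2 / 4 - a * g := by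
          field_simp
          ring
        linarith
    _ = _ := by
      field_simp

/-- The bilinear form `ν (∇v, ∇w) + γ (∇ · v, ∇ · w) + μ (I_H v, I_H w)`. -/
noncomputable def stepForm (ν γ μ : ℝ) (IH : H10 Ω →ₗ[ℝ] L2 Ω (Vec d)) (v w : H10 Ω) : ℝ :=
  ν * inner ℝ (grad v) (grad w) + γ * inner ℝ (dive v) (dive w) + μ * inner ℝ (IH v) (IH w)

section stepForm

variable {ν γ μ : ℝ} {IH : H10 Ω →ₗ[ℝ] L2 Ω (Vec d)}

theorem stepForm_sub_left (v v' w : H10 Ω) :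
    stepForm ν γ μ IH (v - v') w = stepForm ν γ μ IH v w - stepForm ν γ μ IH v' w := by
  simp only [stepForm, grad_sub, dive_sub, map_sub, inner_sub_left]
  ring

theorem stepForm_add_right (v w w' : H10 Ω) :
    stepForm ν γ μ IH v (w + w') = stepForm ν γ μ IH v w + stepForm ν γ μ IH v w' := by
  simp only [stepForm, grad_add, dive_add, map_add, inner_add_right]
  ring

theorem stepForm_self (v : H10 Ω) :
    stepForm ν γ μ IH v v = ν * ‖grad v‖ ^ 2 + γ * ‖dive v‖ ^ 2 + μ * ‖IH v‖ ^ 2 := by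
  simp only [stepForm, real_inner_self_eq_norm_sq]

theorem stepForm_self_nonneg (hν : 0 ≤ ν) (hγ : 0 ≤ γ) (hμ : 0 ≤ μ) (v : H10 Ω) :
    0 ≤ stepForm ν γ μ IH v v := by
  rw [stepForm_self]
  positivity

theorem sqrt_mul_norm_grad_le (hν : 0 ≤ ν) (hγ : 0 ≤ γ) (hμ : 0 ≤ μ) (v : H10 Ω) :
    √ν * ‖grad v‖ ≤ √(stepForm ν γ μ IH v v) := by
  refine Real.le_sqrt_of_sq_le ?_
  rw [mul_pow, Real.sq_sqrt hν, stepForm_self]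
  have : 0 ≤ γ * ‖dive v‖ ^ 2 + μ * ‖IH v‖ ^ 2 := by positivity
  linarith

theorem abs_stepForm_le (hν : 0 ≤ ν) (hγ : 0 ≤ γ) (hμ : 0 ≤ μ) (v w : H10 Ω) :
    |stepForm ν γ μ IH v w| ≤ √(stepForm ν γ μ IH v v) * √(stepForm ν γ μ IH w w) := by
  have h1 := abs_real_inner_le_norm (grad v) (grad w)
  have h2 := abs_real_inner_le_norm (dive v) (dive w)
  have h3 := abs_real_inner_le_norm (IH v) (IH w)
  have h : |stepForm ν γ μ IH v w| ≤
      ν * (‖grad v‖ * ‖grad w‖) + γ * (‖dive v‖ * ‖dive w‖) + μ * (‖IH v‖ * ‖IH w‖) := by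
    refine (abs_add_three _ _ _).trans ?_
    simp only [abs_mul, abs_of_nonneg hν, abs_of_nonneg hγ, abs_of_nonneg hμ]
    gcongr
  refine h.trans ?_
  rw [← Real.sqrt_mul (stepForm_self_nonneg hν hγ hμ v)]
  refine Real.le_sqrt_of_sq_le ?_
  rw [stepForm_self, stepForm_self]
  -- Lagrange's identity: these squares are the deficit in the weighted Cauchy-Schwarz inequality
  -- for three terms.
  have e1 := mul_nonneg (mul_nonneg hν hγ) (sq_nonneg (‖grad v‖ * ‖dive w‖ - ‖dive v‖ * ‖grad w‖))
  have e2 := mul_nonneg (mul_nonneg hν hμ) (sq_nonneg (‖grad v‖ * ‖IH w‖ - ‖IH v‖ * ‖grad w‖))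
  have e3 := mul_nonneg (mul_nonneg hγ hμ) (sq_nonneg (‖dive v‖ * ‖IH w‖ - ‖IH v‖ * ‖dive w‖))
  linarith

/-- Nudging controls only ‖I_H v‖; the interpolation error C₁H‖∇v‖ needed to recover ‖v‖ is absorbed
by viscosity. -/
theorem mul_norm_val_sq_le {l C₁ H : ℝ} (hl : 0 ≤ l) (hlμ : l ≤ μ)
    (hlH : 2 * (l * (C₁ * H) ^ 2) ≤ ν) {v : H10 Ω} (hIH : ‖IH v - val v‖ ≤ C₁ * H * ‖grad v‖) :
    l * ‖val v‖ ^ 2 ≤ 2 * (μ * ‖IH v‖ ^ 2) + ν * ‖grad v‖ ^ 2 := by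
  have h1 : ‖val v‖ ≤ ‖IH v‖ + C₁ * H * ‖grad v‖ := by
    have := norm_sub_le (IH v) (IH v - val v)
    rw [sub_sub_cancel] at this
    linarith
  calc l * ‖val v‖ ^ 2 ≤ l * (‖IH v‖ + C₁ * H * ‖grad v‖) ^ 2 := by gcongr
    _ ≤ l * (2 * ‖IH v‖ ^ 2 + 2 * (C₁ * H * ‖grad v‖) ^ 2) := by
      gcongr
      nlinarith [sq_nonneg (‖IH v‖ - C₁ * H * ‖grad v‖)]
    _ = 2 * (l * ‖IH v‖ ^ 2) + 2 * (l * (C₁ * H) ^ 2) * ‖grad v‖ ^ 2 := by ring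
    _ ≤ _ := by gcongr

end stepForm

/-! ### Consequences of the inf-sup condition and the scalar core of the contraction. -/

theorem InfSup.mul_norm_le {Xh : Submodule ℝ (H10 Ω)} {Qh : Submodule ℝ (L2 Ω ℝ)} {β : ℝ}
    (h : InfSup Xh Qh β) {q : L2 Ω ℝ} (hq : q ∈ Qh) {c : ℝ} (hc0 : 0 ≤ c)
    (hc : ∀ v ∈ Xh, inner ℝ (dive v) q ≤ c * ‖grad v‖) : β * ‖q‖ ≤ c := by
  rcases eq_or_ne q 0 with rfl | hq0
  · simpa using hc0
  rw [← le_div_iff₀ (norm_pos_iff.2 hq0)]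
  refine (h.2 q hq hq0).trans (Real.iSup_le (fun v => ?_) (by positivity))
  refine div_le_of_le_mul₀ (by positivity) (by positivity) ((hc v.1 v.2.1).trans_eq ?_)
  have := norm_ne_zero_iff.2 hq0
  field_simp

theorem InfSup.le_one {Xh : Submodule ℝ (H10 Ω)} {Qh : Submodule ℝ (L2 Ω ℝ)} {β : ℝ}
    (h : InfSup Xh Qh β) (hQh : Qh ≠ ⊥) : β ≤ 1 := by
  obtain ⟨q, hq, hq0⟩ := Submodule.exists_mem_ne_zero_of_ne_bot hQh
  have := h.mul_norm_le hq (norm_nonneg q) fun v _ =>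
    (real_inner_le_norm _ _).trans (by rw [mul_comm]; gcongr; exact norm_dive_le v)
  exact le_of_mul_le_mul_right (by simpa using this) (norm_pos_iff.2 hq0)

/-- The scalar inequalities of the convergence proof: `s`, `t` are the energy norms of the velocity
error and of the splitting error, `r` is the scaled squared pressure error, and `P` the weighted
velocity error. -/
theorem contraction_of_scalar_bounds {s t g q x k E r P β : ℝ} (hs : 0 ≤ s) (ht : 0 ≤ t)
    (hg : 0 ≤ g) (hq : 0 ≤ q) (hx : 0 ≤ x) (hk : 0 ≤ k) (hE : 0 ≤ E) (hr : 0 ≤ r)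
    (hβ : 0 ≤ β) (hβ1 : β ≤ 1) (hkβ : 108 * k ≤ β ^ 2)
    (hgE : g ^ 2 ≤ k * E) (hqP : q ^ 2 ≤ k * P) (hP : P ≤ 2 * s ^ 2)
    (h1 : s ^ 2 ≤ s * t + g * (s + t) + q * t) (h2 : t ^ 2 ≤ k * (r + 2 * E))
    (hx6 : x ^ 2 ≤ 6 * s ^ 2) (h3 : β ^ 2 * r ≤ (x + g + q) ^ 2) :
    β ^ 2 * (P + r / 2) ≤ 108 * k * E := by
  have hβ2 : β ^ 2 ≤ 1 := pow_le_one₀ hβ hβ1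
  have hk1 : k ≤ 1 / 108 := by linarith
  -- q² ≤ 2ks² ≤ s²/54, and 54 ≥ 7².
  have hqs : q ≤ s / 7 := by
    refine abs_le_of_sq_le_sq' ?_ (by positivity) |>.2
    nlinarith [mul_le_mul_of_nonneg_left hP hk, mul_le_mul_of_nonneg_right hk1 (sq_nonneg s)]
  have hS : s ^ 2 ≤ 3 * g ^ 2 + 4 * t ^ 2 := by
    nlinarith [mul_le_mul_of_nonneg_right hqs ht, sq_nonneg (s / 2 - g), sq_nonneg (g - t),
      sq_nonneg (s / 2 - 8 / 7 * t)]
  have hS' : s ^ 2 ≤ k * (11 * E + 4 * r) := by nlinarith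
  have hxs : x ≤ 2.45 * s := by
    refine abs_le_of_sq_le_sq' ?_ (by positivity) |>.2
    nlinarith
  have hsum : (x + g + q) ^ 2 ≤ 8 * s ^ 2 + 7 * g ^ 2 := by
    have : (x + g + q) ^ 2 ≤ (2.593 * s + g) ^ 2 :=
      pow_le_pow_left₀ (by positivity) (by linarith) 2
    nlinarith [sq_nonneg (1.12 * s - 2.4 * g)]
  have hr1 : β ^ 2 * r ≤ k * (95 * E + 32 * r) := by nlinarith
  -- Absorption: 32kr ≤ (32/108)β²r, and 95 / (1 - 32/108) = 135.
  have hr2 : β ^ 2 * r ≤ 135 * (k * E) := by nlinarith [mul_le_mul_of_nonneg_right hkβ hr]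
  have hkE := mul_nonneg hk hE
  have hP' : P ≤ 22 * (k * E) + 8 * (k * r) := by linarith
  have h4 : β ^ 2 * (k * r) ≤ 135 / 108 * (k * E) := by
    calc β ^ 2 * (k * r) = k * (β ^ 2 * r) := by ring
      _ ≤ k * (135 * (k * E)) := by gcongr
      _ = 135 * k * (k * E) := by ring
      _ ≤ 135 * (1 / 108) * (k * E) := by gcongr
      _ = _ := by ring
  have h5 : β ^ 2 * P ≤ 22 * (k * E) + 10 * (k * E) := by
    calc β ^ 2 * P ≤ β ^ 2 * (22 * (k * E) + 8 * (k * r)) := by gcongr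
      _ = β ^ 2 * (22 * (k * E)) + 8 * (β ^ 2 * (k * r)) := by ring
      _ ≤ 1 * (22 * (k * E)) + 8 * (135 / 108 * (k * E)) := by gcongr
      _ = _ := by ring
  -- The sum is 32 + 135/2 = 99.5, below 108.
  linarith

/-- The velocity part `l ‖v‖² + (ν/4) ‖∇v‖²` of the combined error. -/
noncomputable def velE (ν l : ℝ) (v : H10 Ω) : ℝ := l * ‖val v‖ ^ 2 + ν / 4 * ‖grad v‖ ^ 2

theorem velE_nonneg {ν l : ℝ} (hν : 0 ≤ ν) (hl : 0 ≤ l) (v : H10 Ω) : 0 ≤ velE ν l v := by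
  rw [velE]
  positivity

theorem errE_eq (ν γ l : ℝ) (v : H10 Ω) (r : L2 Ω ℝ) :
    errE ν γ l v r = velE ν l v + γ⁻¹ * ‖r‖ ^ 2 / 2 := by
  rw [errE, velE]
  ring

section trilinear

variable {M ν τ c : ℝ}

theorem IsTrilinearConst.abs_b_le_sqrt_velE_left (hM : IsTrilinearConst Ω M) (hν : 0 < ν)
    (hc : 0 < c) {v : H10 Ω} (hv : M * ‖grad v‖ ≤ ν * τ) (χ w : H10 Ω) :
    |b χ v w| ≤ √(τ ^ 2 * c * velE ν (ν / c ^ 2) χ) * (√ν * ‖grad w‖) := by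
  have := mul_sqrt_mul_sqrt_le hν hc (norm_nonneg (val χ)) (norm_nonneg (grad χ))
    (mul_nonneg hM.1.le (norm_nonneg _)) hv
  calc |b χ v w| ≤ _ := hM.abs_b_le_left χ v w
    _ = (M * ‖grad v‖ * (√‖val χ‖ * √‖grad χ‖)) * ‖grad w‖ := by ring
    _ ≤ _ := mul_le_mul_of_nonneg_right this (norm_nonneg _)
    _ = _ := by rw [velE]; ring

theorem IsTrilinearConst.abs_b_le_sqrt_velE_mid (hM : IsTrilinearConst Ω M) (hν : 0 < ν)
    (hc : 0 < c) {χ : H10 Ω} (hχ : M * ‖grad χ‖ ≤ ν * τ) (v w : H10 Ω) :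
    |b χ v w| ≤ √(τ ^ 2 * c * velE ν (ν / c ^ 2) v) * (√ν * ‖grad w‖) := by
  have := mul_sqrt_mul_sqrt_le hν hc (norm_nonneg (val v)) (norm_nonneg (grad v))
    (mul_nonneg hM.1.le (norm_nonneg _)) hχ
  calc |b χ v w| ≤ _ := hM.abs_b_le_mid χ v w
    _ = (M * ‖grad χ‖ * (√‖val v‖ * √‖grad v‖)) * ‖grad w‖ := by ring
    _ ≤ _ := mul_le_mul_of_nonneg_right this (norm_nonneg _)
    _ = _ := by rw [velE]; ring

end trilinear

/-! ### A priori bound and the error equations of one step. -/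

section equations

variable {Xh : Submodule ℝ (H10 Ω)} {Qh : Submodule ℝ (L2 Ω ℝ)} {K ν γ μ : ℝ}
  {f : H10 Ω →L[ℝ] ℝ} {IH : H10 Ω →ₗ[ℝ] L2 Ω (Vec d)} {u u₀ u' : H10 Ω} {p p₀ p' : L2 Ω ℝ}

/-- Test with u: skew-symmetry kills convection, the discrete divergence constraint kills the
pressure, and the grad-div term is nonnegative. -/
theorem IsNSESolution.mul_norm_grad_le {CP : ℝ} (hCP : IsPoincareConst Ω CP) (hγ : 0 ≤ γ)
    (h : IsNSESolution Xh Qh ν γ f u p) : ν * ‖grad u‖ ≤ dualNorm f := by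
  obtain ⟨hu, hp, hmom, hdiv⟩ := h
  have h1 := hmom u hu
  have h2 := hdiv p hp
  rw [real_inner_comm] at h2
  rw [b_self, h2, real_inner_self_eq_norm_sq, real_inner_self_eq_norm_sq] at h1
  have h3 := le_dualNorm_mul hCP f u
  rcases (norm_nonneg (grad u)).eq_or_lt with h | h
  · rw [← h]
    simpa using dualNorm_nonneg f
  · refine le_of_mul_le_mul_right ?_ h
    nlinarith [mul_nonneg hγ (sq_nonneg ‖dive u‖)]

theorem IsNSESolution.stepForm_error_eq (hK : IsTripleConst Ω K)
    (hNSE : IsNSESolution Xh Qh ν γ f u p) {v : H10 Ω} (hv : v ∈ Xh)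
    (h : ν * inner ℝ (grad u') (grad v) + γ * inner ℝ (dive u') (dive v) + b u₀ u' v
      + μ * inner ℝ (IH u') (IH v) = f v + μ * inner ℝ (IH u) (IH v) + inner ℝ p' (dive v)) :
    stepForm ν γ μ IH (u - u') v + b (u - u₀) u v + b u₀ (u - u') v =
      inner ℝ (p - p') (dive v) := by
  have h1 := hNSE.2.2.1 v hv
  rw [stepForm_sub_left, hK.b_sub_left, hK.b_sub_mid, inner_sub_left p p' (dive v)]
  simp only [stepForm]
  linarith

/-- Substeps one and two together miss the third only by the convection of w, so that is the only
source for y. -/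
theorem IsTripleConst.stepForm_splitting_error_eq (hK : IsTripleConst Ω K) {z w y v : H10 Ω}
    (hy : y = u' - z - w)
    {g : L2 Ω (Vec d)} {δ : L2 Ω ℝ}
    (h1 : ν * inner ℝ (grad z) (grad v) + γ * inner ℝ (dive z) (dive v) + b u₀ z v
      + μ * inner ℝ (IH z) (IH v) = f v + μ * inner ℝ g (IH v) + inner ℝ p₀ (dive v))
    (h2 : ν * inner ℝ (grad w) (grad v) + γ * inner ℝ (dive w) (dive v)
      - inner ℝ δ (dive v) + μ * inner ℝ (IH w) (IH v) = 0)
    (h3 : ν * inner ℝ (grad u') (grad v) + γ * inner ℝ (dive u') (dive v) + b u₀ u' v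
      + μ * inner ℝ (IH u') (IH v) = f v + μ * inner ℝ g (IH v) + inner ℝ (p₀ + δ) (dive v)) :
    stepForm ν γ μ IH y v + b u₀ y v + b u₀ w v = 0 := by
  rw [inner_add_left p₀ δ (dive v)] at h3
  rw [hy, stepForm_sub_left, stepForm_sub_left, hK.b_sub_mid, hK.b_sub_mid]
  simp only [stepForm]
  linarith

/-- Here u - u' + y = u - (z + w), and w is built to cancel the discrete divergence of z. -/
theorem inner_dive_add_eq_zero {z w y : H10 Ω} {q : L2 Ω ℝ} (hy : y = u' - z - w)
    (h1 : inner ℝ (dive u) q = 0) (h2 : inner ℝ (dive w) q = -inner ℝ (dive z) q) :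
    inner ℝ q (dive (u - u' + y)) = 0 := by
  have h3 : u - u' + y = u - (z + w) := by rw [hy]; abel
  have h4 : dive (u - u' + y) = dive u - (dive z + dive w) := by
    rw [h3, dive_sub u (z + w), dive_add z w]
  rw [h4, real_inner_comm _ q, inner_sub_left (dive u) _ q, inner_add_left (dive z) _ q, h1, h2]
  ring

theorem IsTripleConst.expand_error_eq (hK : IsTripleConst Ω K) {e e₀ y : H10 Ω}
    (h : stepForm ν γ μ IH e (e + y) + b e₀ u (e + y) + b u₀ e (e + y) = 0) :
    stepForm ν γ μ IH e e + stepForm ν γ μ IH e y + b e₀ u (e + y) + b u₀ e y = 0 := by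
  rw [stepForm_add_right e e y, hK.b_add_right u₀ e e y, b_self u₀ e] at h
  linarith

/-- The error equations of one step: `w` is the correction of the second substep, `δ` the pressure
increment and `y` the splitting error. -/
theorem IsTripleConst.exists_error_equations (hK : IsTripleConst Ω K)
    (hNSE : IsNSESolution Xh Qh ν γ f u p) (hp₀ : p₀ ∈ Qh)
    (hstep : IsCDAIPYStep Xh Qh ν γ μ f IH (IH u) u₀ p₀ u' p') :
    p - p' ∈ Qh ∧
    (∀ v ∈ Xh, stepForm ν γ μ IH (u - u') v + b (u - u₀) u v + b u₀ (u - u') v =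
      inner ℝ (p - p') (dive v)) ∧
    ∃ w y : H10 Ω,
      stepForm ν γ μ IH w w = inner ℝ (p' - p₀) (dive w) ∧
      stepForm ν γ μ IH y y + b u₀ w y = 0 ∧
      stepForm ν γ μ IH (u - u') (u - u') + stepForm ν γ μ IH (u - u') y +
        b (u - u₀) u (u - u' + y) + b u₀ (u - u') y = 0 := by
  obtain ⟨z, hz, w, hw, δ, hδ, hz1, hw1, hw2, rfl, hu', hu1⟩ := hstep
  obtain ⟨y, hy⟩ : ∃ y, y = u' - z - w := ⟨_, rfl⟩
  have hyX : y ∈ Xh := hy ▸ Xh.sub_mem (Xh.sub_mem hu' hz) hw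
  have heX : u - u' ∈ Xh := Xh.sub_mem hNSE.1 hu'
  have hrQ : p - (p₀ + δ) ∈ Qh := Qh.sub_mem hNSE.2.1 (Qh.add_mem hp₀ hδ)
  have eq1 := fun v hv => hNSE.stepForm_error_eq hK hv (hu1 v hv)
  refine ⟨hrQ, eq1, w, y, ?_, ?_, ?_⟩
  · have := hw1 w hw
    rw [add_sub_cancel_left]
    simp only [stepForm]
    linarith
  · have := hK.stepForm_splitting_error_eq hy (hz1 _ hyX) (hw1 _ hyX) (hu1 _ hyX)
    linarith [b_self u₀ y]
  · have horth := inner_dive_add_eq_zero hy (hNSE.2.2.2 _ hrQ) (hw2 _ hrQ)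
    exact hK.expand_error_eq ((eq1 _ (Xh.add_mem heX hyX)).trans horth)

end equations

/-! ### Energy and pressure estimates. -/

section estimates

variable {ν γ μ l k : ℝ} {IH : H10 Ω →ₗ[ℝ] L2 Ω (Vec d)}

theorem velE_le_of_stepForm_eq (hν : 0 < ν) (hγ : 0 < γ) {w : H10 Ω} {r r₀ : L2 Ω ℝ}
    (hlv : l * ‖val w‖ ^ 2 ≤ 2 * (μ * ‖IH w‖ ^ 2) + ν * ‖grad w‖ ^ 2)
    (hw : stepForm ν γ μ IH w w = inner ℝ (r₀ - r) (dive w)) :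
    velE ν l w ≤ γ⁻¹ * ‖r‖ ^ 2 + γ⁻¹ * ‖r₀‖ ^ 2 := by
  -- Young's weight is chosen so that γ‖∇ · w‖² cancels exactly against the grad-div term of the
  -- energy.
  have h1 : inner ℝ (r₀ - r) (dive w) ≤ γ * ‖dive w‖ ^ 2 + γ⁻¹ * ‖r₀ - r‖ ^ 2 / 4 := by
    have h := real_inner_le_norm (r₀ - r) (dive w)
    have h' : 0 ≤ γ * (‖dive w‖ - γ⁻¹ * ‖r₀ - r‖ / 2) ^ 2 := by positivity
    have h'' : γ * (‖dive w‖ - γ⁻¹ * ‖r₀ - r‖ / 2) ^ 2 =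
        γ * ‖dive w‖ ^ 2 + γ⁻¹ * ‖r₀ - r‖ ^ 2 / 4 - ‖r₀ - r‖ * ‖dive w‖ := by
      field_simp
      ring
    linarith
  rw [← hw, stepForm_self] at h1
  have h3 : γ⁻¹ * ‖r₀ - r‖ ^ 2 ≤ γ⁻¹ * (2 * ‖r₀‖ ^ 2 + 2 * ‖r‖ ^ 2) := by
    gcongr
    nlinarith [sq_nonneg (‖r₀‖ - ‖r‖), norm_nonneg (r₀ - r), norm_sub_le r₀ r]
  have h5 : 0 ≤ ν * ‖grad w‖ ^ 2 := by positivity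
  rw [velE]
  linarith

theorem stepForm_self_le_of_add_b_eq_zero (hν : 0 ≤ ν) (hγ : 0 ≤ γ) (hμ : 0 ≤ μ) {m : ℝ}
    (hm : 0 ≤ m) {u₀ w y : H10 Ω} (hb : |b u₀ w y| ≤ √m * (√ν * ‖grad y‖))
    (hy : stepForm ν γ μ IH y y + b u₀ w y = 0) : stepForm ν γ μ IH y y ≤ m := by
  have hyt := sqrt_mul_norm_grad_le (IH := IH) hν hγ hμ y
  have ht2 := Real.sq_sqrt (stepForm_self_nonneg (IH := IH) hν hγ hμ y)
  have h1 := (neg_le_abs _).trans hb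
  have h2 := mul_le_mul_of_nonneg_left hyt (Real.sqrt_nonneg m)
  have h3 := Real.sq_sqrt hm
  nlinarith [sq_nonneg (√m - √(stepForm ν γ μ IH y y))]

theorem stepForm_self_le_of_error_equation (hν : 0 ≤ ν) (hγ : 0 ≤ γ) (hμ : 0 ≤ μ)
    {u u₀ e e₀ y : H10 Ω} {g q : ℝ} (hg0 : 0 ≤ g) (hq0 : 0 ≤ q)
    (hg : ∀ v, |b e₀ u v| ≤ g * (√ν * ‖grad v‖)) (hq : |b u₀ e y| ≤ q * (√ν * ‖grad y‖))
    (h : stepForm ν γ μ IH e e + stepForm ν γ μ IH e y + b e₀ u (e + y) + b u₀ e y = 0) :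
    stepForm ν γ μ IH e e ≤ √(stepForm ν γ μ IH e e) * √(stepForm ν γ μ IH y y) +
      g * (√(stepForm ν γ μ IH e e) + √(stepForm ν γ μ IH y y)) +
      q * √(stepForm ν γ μ IH y y) := by
  have he := sqrt_mul_norm_grad_le (IH := IH) hν hγ hμ e
  have hy := sqrt_mul_norm_grad_le (IH := IH) hν hγ hμ y
  have h1 := (neg_le_abs _).trans (abs_stepForm_le (IH := IH) hν hγ hμ e y)
  have h2 := (neg_le_abs _).trans (hg (e + y))
  have h3 := (neg_le_abs _).trans hq
  have h4 : √ν * ‖grad (e + y)‖ ≤ √(stepForm ν γ μ IH e e) + √(stepForm ν γ μ IH y y) := by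
    have := mul_le_mul_of_nonneg_left (norm_add_le (grad e) (grad y)) (Real.sqrt_nonneg ν)
    rw [grad_add]
    linarith
  have h5 := mul_le_mul_of_nonneg_left h4 hg0
  have h6 := mul_le_mul_of_nonneg_left hy hq0
  linarith

/-- Every term is bounded with a common factor √γ, so that γ⁻¹‖r‖² is controlled without γ: ν ≤ γ
handles viscosity and convection, and the hypothesis on μC₁²C_P handles nudging. -/
theorem InfSup.mul_norm_pressure_le {Xh : Submodule ℝ (H10 Ω)} {Qh : Submodule ℝ (L2 Ω ℝ)}
    {β CP C₁ g q : ℝ} (hβ : InfSup Xh Qh β) (hCP : IsPoincareConst Ω CP) (hC₁ : 0 ≤ C₁)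
    (hIH : ∀ v, ‖IH v‖ ≤ C₁ * ‖val v‖) (hν : 0 ≤ ν) (hγν : ν ≤ γ) (hμ : 0 ≤ μ)
    (hμγ : μ * C₁ ^ 2 * CP ≤ √γ * √l) {u u₀ e e₀ : H10 Ω} {r : L2 Ω ℝ} (hr : r ∈ Qh)
    (hg0 : 0 ≤ g) (hq0 : 0 ≤ q) (hg : ∀ v, |b e₀ u v| ≤ g * (√ν * ‖grad v‖))
    (hq : ∀ v, |b u₀ e v| ≤ q * (√ν * ‖grad v‖))
    (h : ∀ v ∈ Xh, stepForm ν γ μ IH e v + b e₀ u v + b u₀ e v = inner ℝ r (dive v)) :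
    β * ‖r‖ ≤ √γ * ((√ν * ‖grad e‖ + √γ * ‖dive e‖ + √l * ‖val e‖) + g + q) := by
  have hγ : 0 ≤ γ := hν.trans hγν
  have hsνγ : √ν ≤ √γ := Real.sqrt_le_sqrt hγν
  refine hβ.mul_norm_le hr (by positivity) fun v hv => ?_
  rw [real_inner_comm, ← h v hv]
  have h1 := (le_abs_self _).trans (hg v)
  have h2 := (le_abs_self _).trans (hq v)
  have h3 : ν * inner ℝ (grad e) (grad v) ≤ √γ * (√ν * ‖grad e‖) * ‖grad v‖ := by
    calc ν * inner ℝ (grad e) (grad v) ≤ ν * (‖grad e‖ * ‖grad v‖) := by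
          gcongr; exact real_inner_le_norm _ _
      _ = √ν * (√ν * ‖grad e‖) * ‖grad v‖ := by
          nth_rewrite 1 [← Real.mul_self_sqrt hν]; ring
      _ ≤ _ := by gcongr
  have h4 : γ * inner ℝ (dive e) (dive v) ≤ √γ * (√γ * ‖dive e‖) * ‖grad v‖ := by
    calc γ * inner ℝ (dive e) (dive v) ≤ γ * (‖dive e‖ * ‖grad v‖) := by
          gcongr
          refine (real_inner_le_norm _ _).trans ?_
          gcongr
          exact norm_dive_le v
      _ = _ := by nth_rewrite 1 [← Real.mul_self_sqrt hγ]; ring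
  have h5 : μ * inner ℝ (IH e) (IH v) ≤ √γ * (√l * ‖val e‖) * ‖grad v‖ := by
    calc μ * inner ℝ (IH e) (IH v) ≤ μ * ((C₁ * ‖val e‖) * (C₁ * (CP * ‖grad v‖))) := by
          gcongr
          refine (real_inner_le_norm _ _).trans ?_
          gcongr
          · exact hIH e
          · exact (hIH v).trans (by gcongr; exact hCP.2 v)
      _ = (μ * C₁ ^ 2 * CP) * ‖val e‖ * ‖grad v‖ := by ring
      _ ≤ (√γ * √l) * ‖val e‖ * ‖grad v‖ := by gcongr
      _ = _ := by ring
  have h6 : g * (√ν * ‖grad v‖) ≤ g * (√γ * ‖grad v‖) := by gcongr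
  have h7 : q * (√ν * ‖grad v‖) ≤ q * (√γ * ‖grad v‖) := by gcongr
  rw [stepForm]
  linarith

theorem sq_pressure_bound_le (hν : 0 ≤ ν) (hγ : 0 ≤ γ) (hl : 0 ≤ l) {e : H10 Ω}
    (hlv : l * ‖val e‖ ^ 2 ≤ 2 * (μ * ‖IH e‖ ^ 2) + ν * ‖grad e‖ ^ 2) :
    (√ν * ‖grad e‖ + √γ * ‖dive e‖ + √l * ‖val e‖) ^ 2 ≤ 6 * stepForm ν γ μ IH e e := by
  have h1 : (√ν * ‖grad e‖ + √γ * ‖dive e‖ + √l * ‖val e‖) ^ 2 ≤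
      3 * ((√ν * ‖grad e‖) ^ 2 + (√γ * ‖dive e‖) ^ 2 + (√l * ‖val e‖) ^ 2) := by
    linarith [sq_nonneg (√ν * ‖grad e‖ - √γ * ‖dive e‖),
      sq_nonneg (√ν * ‖grad e‖ - √l * ‖val e‖), sq_nonneg (√γ * ‖dive e‖ - √l * ‖val e‖)]
  simp only [mul_pow, Real.sq_sqrt hν, Real.sq_sqrt hγ, Real.sq_sqrt hl] at h1
  have h3 : 0 ≤ γ * ‖dive e‖ ^ 2 := by positivity
  rw [stepForm_self]
  linarith

end estimates

/-! ### Assembly of the contraction and matching of the constants. -/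

section

variable {Xh : Submodule ℝ (H10 Ω)} {Qh : Submodule ℝ (L2 Ω ℝ)} {K β CP C₁ H ν γ μ l k g : ℝ}
  {IH : H10 Ω →ₗ[ℝ] L2 Ω (Vec d)} {u u₀ e e₀ w y : H10 Ω} {r r₀ : L2 Ω ℝ}

/-- Contraction of the error, for given bounds of the convection terms. -/
theorem sq_mul_errE_le (hCP : IsPoincareConst Ω CP)
    (hQh : Qh ≠ ⊥) (hβ : InfSup Xh Qh β) (hC₁ : 0 ≤ C₁)
    (hIH : ∀ v, ‖IH v - val v‖ ≤ C₁ * H * ‖grad v‖) (hIH' : ∀ v, ‖IH v‖ ≤ C₁ * ‖val v‖)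
    (hν : 0 < ν) (hγν : ν ≤ γ) (hl : 0 ≤ l) (hlμ : l ≤ μ) (hlH : 2 * (l * (C₁ * H) ^ 2) ≤ ν)
    (hμγ : μ * C₁ ^ 2 * CP ≤ √γ * √l) (hk : 0 ≤ k) (hkβ : 108 * k ≤ β ^ 2) (hg0 : 0 ≤ g)
    (hgE : g ^ 2 ≤ k * errE ν γ l e₀ r₀) (hg : ∀ v, |b e₀ u v| ≤ g * (√ν * ‖grad v‖))
    (hb : ∀ v w, |b u₀ v w| ≤ √(k * velE ν l v) * (√ν * ‖grad w‖)) (hrQ : r ∈ Qh)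
    (eq1 : ∀ v ∈ Xh, stepForm ν γ μ IH e v + b e₀ u v + b u₀ e v = inner ℝ r (dive v))
    (hw : stepForm ν γ μ IH w w = inner ℝ (r₀ - r) (dive w))
    (hy : stepForm ν γ μ IH y y + b u₀ w y = 0)
    (he : stepForm ν γ μ IH e e + stepForm ν γ μ IH e y + b e₀ u (e + y) + b u₀ e y = 0) :
    β ^ 2 * errE ν γ l e r ≤ 108 * k * errE ν γ l e₀ r₀ := by
  have hγ : 0 < γ := hν.trans_le hγν
  have hμ : 0 ≤ μ := hl.trans hlμ
  have hlv : ∀ v, l * ‖val v‖ ^ 2 ≤ 2 * (μ * ‖IH v‖ ^ 2) + ν * ‖grad v‖ ^ 2 := fun v =>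
    mul_norm_val_sq_le hl hlμ hlH (hIH v)
  have hF := fun v : H10 Ω => velE_nonneg hν.le hl v
  have hr₀ : 0 ≤ γ⁻¹ * ‖r₀‖ ^ 2 := by positivity
  have hE := errE_eq ν γ l e₀ r₀
  have hγd : 0 ≤ γ * ‖dive e‖ ^ 2 := by positivity
  have hνg : 0 ≤ ν * ‖grad e‖ ^ 2 := by positivity
  have hs2 := Real.sq_sqrt (stepForm_self_nonneg (IH := IH) hν.le hγ.le hμ e)
  have ht2 := Real.sq_sqrt (stepForm_self_nonneg (IH := IH) hν.le hγ.le hμ y)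
  rw [errE_eq ν γ l e r]
  -- The scalar r is γ⁻¹‖r‖², P is `velE` of e, and q = √(kP) measures b(u₀, e, ·).
  refine contraction_of_scalar_bounds (Real.sqrt_nonneg (stepForm ν γ μ IH e e))
    (Real.sqrt_nonneg (stepForm ν γ μ IH y y)) hg0 (Real.sqrt_nonneg (k * velE ν l e))
    (x := √ν * ‖grad e‖ + √γ * ‖dive e‖ + √l * ‖val e‖) (by positivity) hk
    (by linarith [hF e₀]) (by positivity) hβ.1.le (hβ.le_one hQh) hkβ hgE
    (Real.sq_sqrt (mul_nonneg hk (hF e))).le ?_ ?_ ?_ ?_ ?_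
  · rw [hs2, stepForm_self, velE]
    linarith [hlv e]
  · rw [hs2]
    exact stepForm_self_le_of_error_equation hν.le hγ.le hμ hg0 (Real.sqrt_nonneg _) hg (hb e y) he
  · rw [ht2]
    refine (stepForm_self_le_of_add_b_eq_zero hν.le hγ.le hμ (mul_nonneg hk (hF w)) (hb w y)
      hy).trans ?_
    gcongr
    refine (velE_le_of_stepForm_eq hν hγ (hlv w) hw).trans ?_
    linarith [hF e₀]
  · rw [hs2]
    exact sq_pressure_bound_le hν.le hγ.le hl (hlv e)
  · have h := hβ.mul_norm_pressure_le hCP hC₁ hIH' hν.le hγν hμ hμγ hrQ hg0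
      (Real.sqrt_nonneg (k * velE ν l e)) hg (hb e) eq1
    have hβ0 := hβ.1
    calc β ^ 2 * (γ⁻¹ * ‖r‖ ^ 2) = γ⁻¹ * (β * ‖r‖) ^ 2 := by ring
      _ ≤ γ⁻¹ * (√γ * (√ν * ‖grad e‖ + √γ * ‖dive e‖ + √l * ‖val e‖ + g +
          √(k * velE ν l e))) ^ 2 := by gcongr
      _ = _ := by
        rw [mul_pow, Real.sq_sqrt hγ.le]
        field_simp

theorem le_mul_RConst (hν : 0 < ν) (hβ : 0 < β) (α : ℝ) (hC₁ : 0 ≤ C₁) (hH : 0 ≤ H) :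
    108 * ((α * (1 + (√ν)⁻¹)) ^ 2 * (√2 * C₁ * H)) ≤ β ^ 2 * (α ^ 2 * H * RConst ν C₁ β) := by
  have hn : ν⁻¹ = (√ν)⁻¹ ^ 2 := by rw [inv_pow, Real.sq_sqrt hν.le]
  have h1 : β ^ 2 * (α ^ 2 * H * RConst ν C₁ β) =
      α ^ 2 * (√2 * C₁ * H) * (204 * (√ν)⁻¹ ^ 2 + 24 * (√ν)⁻¹ + 204) := by
    rw [RConst, hn]
    field_simp
  -- With n = ν^{-1/2}, 204n² + 24n + 204 - 108(1 + n)² = 96(n - 1)²; 108 is the largest constant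
  -- for which this is never negative.
  have h2 : 0 ≤ α ^ 2 * (√2 * C₁ * H) * (96 * ((√ν)⁻¹ - 1) ^ 2) := by positivity
  rw [h1]
  linarith

end

/-- The closeness assumption gives ‖∇(u₀ - u)‖ ≤ ν^{-1/2}‖∇u‖, hence the factor 1 + ν^{-1/2}. -/
theorem mul_norm_grad_le_of_near {M ν τ : ℝ} (hM : 0 ≤ M) (hν : 0 < ν) {u u₀ : H10 Ω}
    (hu : M * ‖grad u‖ ≤ ν * τ) (h : ν * ‖grad (u₀ - u)‖ ^ 2 ≤ ‖grad u‖ ^ 2) :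
    M * ‖grad u₀‖ ≤ ν * (τ * (1 + (√ν)⁻¹)) := by
  have h1 : ‖grad (u₀ - u)‖ ≤ (√ν)⁻¹ * ‖grad u‖ := by
    rw [← div_eq_inv_mul, le_div_iff₀ (by positivity)]
    refine abs_le_of_sq_le_sq' ?_ (by positivity) |>.2
    rw [mul_pow, Real.sq_sqrt hν.le]
    linarith
  have h2 : ‖grad u₀‖ ≤ ‖grad (u₀ - u)‖ + ‖grad u‖ := by
    rw [grad_sub]
    simpa using norm_add_le (grad u₀ - grad u) (grad u)
  calc M * ‖grad u₀‖ ≤ M * ((√ν)⁻¹ * ‖grad u‖ + ‖grad u‖) := by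
        gcongr
        linarith
    _ = (M * ‖grad u‖) * (1 + (√ν)⁻¹) := by ring
    _ ≤ (ν * τ) * (1 + (√ν)⁻¹) := by gcongr
    _ = _ := by ring

end CDAIPY

theorem mainTheorem1 (d : ℕ) (hd : d = 2 ∨ d = 3) (Ω : Set (Vec d)) (hΩ : IsOpen Ω)
    (hΩb : Bornology.IsBounded Ω) :
    (∃ CP : ℝ, IsPoincareConst Ω CP) ∧ (∃ M : ℝ, IsTrilinearConst Ω M) ∧
    ∀ (CP M : ℝ), IsPoincareConst Ω CP → IsTrilinearConst Ω M →
    -- the discrete spaces and the inf-sup constant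
    ∀ (Xh : Submodule ℝ (H10 Ω)) (Qh : Submodule ℝ (L2 Ω ℝ)) (β : ℝ),
      (Qh : Set (L2 Ω ℝ)) ⊆ L20 Ω → Qh ≠ ⊥ → InfSup Xh Qh β →
    -- the interpolant, with spacing `H` and constant `C₁`
    ∀ (H C₁ : ℝ) (IH : H10 Ω →ₗ[ℝ] L2 Ω (Vec d)), 0 < H → 0 < C₁ →
      (∀ v, ‖IH v - val v‖ ≤ C₁ * H * ‖grad v‖) → (∀ v, ‖IH v‖ ≤ C₁ * ‖val v‖) →
    ∀ (ν γ μ : ℝ) (f : H10 Ω →L[ℝ] ℝ), 0 < ν →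
    -- the solution and the previous iterate
    ∀ (u : H10 Ω) (p : L2 Ω ℝ), IsNSESolution Xh Qh ν γ f u p →
    ∀ (u₀ : H10 Ω) (p₀ : L2 Ω ℝ), u₀ ∈ Xh → p₀ ∈ Qh →
      ν * ‖grad (u₀ - u)‖ ^ 2 ≤ ‖grad u‖ ^ 2 →
    -- `H ≤ min {1 / (α² R), 101 / (204 √2 C₁ α²)}`, no restriction if `α = 0`
      H * (alpha M ν f ^ 2 * RConst ν C₁ β) ≤ 1 →
      H * (204 * √2 * C₁ * alpha M ν f ^ 2) ≤ 101 →
      max (ν * alpha M ν f ^ 2) (ν / (2 * C₁ ^ 2 * H ^ 2)) ≤ μ →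
      max (2 * μ ^ 2 * C₁ ^ 6 * CP ^ 2 * H ^ 2 * ν⁻¹) ν ≤ γ →
    -- the estimate for the result of one step
    ∀ (u' : H10 Ω) (p' : L2 Ω ℝ),
      IsCDAIPYStep Xh Qh ν γ μ f IH (IH u) u₀ p₀ u' p' →
      errE ν γ (lam ν μ C₁ H) (u - u') (p - p') ≤
        alpha M ν f ^ 2 * H * RConst ν C₁ β *
          errE ν γ (lam ν μ C₁ H) (u - u₀) (p - p₀) := by
  refine ⟨exists_isPoincareConst hd hΩb, exists_isTrilinearConst hd hΩb, ?_⟩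
  intro CP M hCP hM Xh Qh β _ hQh hβ H C₁ IH hH hC₁ hIH hIH' ν γ μ f hν u p hNSE u₀ p₀ hu₀ hp₀
    hu₀u hHR _ hμ hγ u' p' hstep
  obtain ⟨K, hK⟩ := exists_isTripleConst (Ω := Ω) hd hΩb
  have hα : M * ‖grad u‖ ≤ ν * alpha M ν f := by
    have h1 := (le_max_right _ _).trans hγ
    have h2 := hNSE.mul_norm_grad_le hCP (hν.le.trans h1)
    have h3 : ν * alpha M ν f = M * (dualNorm f / ν) := by
      rw [alpha]
      field_simp
    rw [h3]
    refine mul_le_mul_of_nonneg_left ?_ hM.1.le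
    rw [le_div_iff₀ hν]
    linarith
  have hα₀ := mul_norm_grad_le_of_near hM.1.le hν hα hu₀u
  revert hα hα₀ hHR
  generalize alpha M ν f = α
  intro hHR hα hα₀
  have hc0 : 0 < √2 * C₁ * H := by positivity
  have hc2 : (√2 * C₁ * H) ^ 2 = 2 * C₁ ^ 2 * H ^ 2 := by
    rw [mul_pow, mul_pow, Real.sq_sqrt (by norm_num)]
  have hμl : ν / (2 * C₁ ^ 2 * H ^ 2) ≤ μ := (le_max_right _ _).trans hμ
  have hl : lam ν μ C₁ H = ν / (√2 * C₁ * H) ^ 2 := by rw [lam, min_eq_right hμl, hc2]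
  have hlH : 2 * (lam ν μ C₁ H * (C₁ * H) ^ 2) ≤ ν := by
    refine le_of_eq ?_
    rw [hl, hc2]
    field_simp
  have hl0 : 0 < lam ν μ C₁ H := by
    rw [hl]
    positivity
  have hlμ : lam ν μ C₁ H ≤ μ := min_le_left _ _
  have hγν : ν ≤ γ := (le_max_right _ _).trans hγ
  have hγ0 : 0 < γ := hν.trans_le hγν
  -- The first lower bound on γ is precisely (μC₁²C_P)² ≤ γλ once λ = ν/(2C₁²H²).
  have hμγ : μ * C₁ ^ 2 * CP ≤ √γ * √(lam ν μ C₁ H) := by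
    rw [← Real.sqrt_mul hγ0.le]
    refine Real.le_sqrt_of_sq_le ?_
    have h1 := (le_max_left _ _).trans hγ
    calc (μ * C₁ ^ 2 * CP) ^ 2 =
          2 * μ ^ 2 * C₁ ^ 6 * CP ^ 2 * H ^ 2 * ν⁻¹ * lam ν μ C₁ H := by
          rw [hl, hc2]
          field_simp
      _ ≤ γ * lam ν μ C₁ H := by gcongr
  have hkR := le_mul_RConst hν hβ.1 α hC₁.le hH.le
  have hkβ : 108 * ((α * (1 + (√ν)⁻¹)) ^ 2 * (√2 * C₁ * H)) ≤ β ^ 2 :=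
    hkR.trans (mul_le_of_le_one_right (sq_nonneg β) (by linarith))
  have hg := hM.abs_b_le_sqrt_velE_left hν hc0 hα (u - u₀)
  have hb := hM.abs_b_le_sqrt_velE_mid hν hc0 hα₀
  rw [← hl] at hg
  simp only [← hl] at hb
  have hF : 0 ≤ velE ν (lam ν μ C₁ H) (u - u₀) := velE_nonneg hν.le hl0.le _
  have hE : velE ν (lam ν μ C₁ H) (u - u₀) ≤ errE ν γ (lam ν μ C₁ H) (u - u₀) (p - p₀) := by
    rw [errE_eq ν γ]
    exact le_add_of_nonneg_right (by positivity)
  -- The bound for b(e₀, u, ·) needs only α; enlarging α to α(1 + ν^{-1/2}) lets one k serve both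
  -- convection terms.
  have hgE : √(α ^ 2 * (√2 * C₁ * H) * velE ν (lam ν μ C₁ H) (u - u₀)) ^ 2 ≤
      (α * (1 + (√ν)⁻¹)) ^ 2 * (√2 * C₁ * H) *
        errE ν γ (lam ν μ C₁ H) (u - u₀) (p - p₀) := by
    rw [Real.sq_sqrt (by positivity), mul_pow]
    have h1 : 1 ≤ (1 + (√ν)⁻¹) ^ 2 := one_le_pow₀ (le_add_of_nonneg_right (by positivity))
    gcongr
    exact le_mul_of_one_le_right (sq_nonneg α) h1
  obtain ⟨hrQ, eq1, w, y, hw, hy, he⟩ := hK.exists_error_equations hNSE hp₀ hstep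
  -- The pressure increment is the difference of the old and new pressure errors.
  have hr : p' - p₀ = (p - p₀) - (p - p') := by abel
  rw [hr] at hw
  have key := sq_mul_errE_le hCP hQh hβ hC₁.le hIH hIH' hν hγν hl0.le hlμ hlH hμγ
    (by positivity) hkβ (Real.sqrt_nonneg _) hgE hg hb hrQ eq1 hw hy he
  refine le_of_mul_le_mul_left ?_ (pow_pos hβ.1 2)
  refine key.trans ((mul_le_mul_of_nonneg_right hkR (hF.trans hE)).trans_eq ?_)
  ring
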